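/- An Orlicz function is a continuous, nondecreasing, convex function $M:[0,\infty)\to[0,\infty)$ with $M(0)=0$, $\lim_{t\to\infty}M(t)=\infty$ and $M(t)>0$ for all $t>0$. For such $M$, let $\ell_M$ be the Banach space of all real sequences $x=(x_n)_{n=1}^\infty$ with $\sum_{n} M(|x_n|/\rho)<\infty$ for some $\rho>0$, with the norm $\|x\|=\inf\{\rho>0:\sum_{n} M(|x_n|/\rho)\le 1\}$, and let $h_M$ be the closed subspace of all $x\in\ell_M$ with $\sum_{n} M(|x_n|/\rho)<\infty$ for every $\rho>0$. The upper Matuszewska–Orlicz index of $M$ is $$\beta_M=\inf\Big\{q\in\mathbb R:\inf_{\lambda,t\in(0,1]}\frac{M(\lambda t)}{M(\lambda)t^q}>0\Big\}\in[1,\infty],\qquad \inf\emptyset=\infty.$$ A map $f:X\to Y$ between metric spaces is a strong uniform embedding if (i) there are nondecreasing functions $\rho_1,\rho_2:[0,\infty)\to[0,\infty)$ with $\lim_{t\to\infty}\rho_1(t)=\infty$ and $\rho_1(d_X(x,y))\le d_Y(f(x),f(y))\le\rho_2(d_X(x,y))$ for all $x,y\in X$, and (ii) $f$ is injective and both $f$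 and $f^{-1}:f(X)\to X$ are uniformly continuous. **Theorem 4.2.** Let $M$ and $N$ be Orlicz functions. If $\beta_M<\beta_N$, or $\beta_N\le\beta_M<2$, or $\beta_M=\beta_N=\infty$, then there is a strong uniform embedding of $h_M$ into $h_N$. -/

import Mathlib

open Filter Set
open scoped NNReal

/-- A nondegenerate Orlicz function: a continuous, nondecreasing, convex function `M` on `[0, ∞)`
with `M 0 = 0`, `M t → ∞` as `t → ∞`, and `M t ≠ 0` for `t > 0`. It is represented by a function
on `ℝ`; its values at negative reals are never used. Nonnegativity follows from monotonicity and
`M 0 = 0`. -/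
structure OrliczFunction where
  toFun : ℝ → ℝ
  continuousOn : ContinuousOn toFun (Ici 0)
  monotoneOn : MonotoneOn toFun (Ici 0)
  convexOn : ConvexOn ℝ (Ici 0) toFun
  map_zero : toFun 0 = 0
  tendsto_atTop : Tendsto toFun atTop atTop
  nondegenerate : ∀ t : ℝ, 0 < t → toFun t ≠ 0

namespace OrliczFunction

instance : CoeFun OrliczFunction (fun _ => ℝ → ℝ) := ⟨toFun⟩

/-- The upper Matuszewska-Orlicz index
`β_M = inf {q ∈ ℝ : inf_{l, t ∈ (0, 1]} M (l t) / (M l * t ^ q) > 0}`, an extended real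
(`⊤` when there is no such `q`). -/
noncomputable def upperIndex (M : OrliczFunction) : EReal :=
  sInf ((fun q : ℝ => (q : EReal)) '' {q : ℝ | ∃ c : ℝ, 0 < c ∧
    ∀ l ∈ Ioc (0 : ℝ) 1, ∀ t ∈ Ioc (0 : ℝ) 1, c ≤ M (l * t) / (M l * t ^ q)})

variable (M : OrliczFunction)

theorem nonneg {t : ℝ} (ht : 0 ≤ t) : 0 ≤ M t := by
  have h := M.monotoneOn (mem_Ici.2 le_rfl) (mem_Ici.2 ht) ht
  rwa [M.map_zero] at h

theorem nonneg_abs_div (a : ℝ) {r : ℝ} (hr : 0 < r) : 0 ≤ M (|a| / r) :=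
  M.nonneg (by positivity)

theorem map_add_le (a b : ℝ) {r s : ℝ} (hr : 0 < r) (hs : 0 < s) :
    M (|a + b| / (r + s)) ≤ r / (r + s) * M (|a| / r) + s / (r + s) * M (|b| / s) := by
  have h1 : M (|a + b| / (r + s)) ≤ M ((|a| + |b|) / (r + s)) :=
    M.monotoneOn (mem_Ici.2 (by positivity)) (mem_Ici.2 (by positivity))
      (by gcongr; exact abs_add_le a b)
  have h2 := M.convexOn.2 (mem_Ici.2 (show 0 ≤ |a| / r by positivity))
    (mem_Ici.2 (show 0 ≤ |b| / s by positivity)) (show 0 ≤ r / (r + s) by positivity)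
    (show 0 ≤ s / (r + s) by positivity) (by field_simp)
  simp only [smul_eq_mul] at h2
  have h3 : r / (r + s) * (|a| / r) + s / (r + s) * (|b| / s) = (|a| + |b|) / (r + s) := by
    field_simp
  rw [h3] at h2
  exact h1.trans h2

theorem map_div_le {t c : ℝ} (ht : 0 ≤ t) (hc : 1 ≤ c) : M (t / c) ≤ c⁻¹ * M t := by
  have hc0 : 0 < c := by linarith
  have h2 := M.convexOn.2 (mem_Ici.2 ht) (mem_Ici.2 (le_refl (0 : ℝ)))
    (show 0 ≤ c⁻¹ by positivity)
    (show 0 ≤ 1 - c⁻¹ by rw [sub_nonneg]; exact inv_le_one_of_one_le₀ hc) (by ring)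
  simp only [smul_eq_mul, M.map_zero, mul_zero, add_zero] at h2
  rwa [div_eq_inv_mul]

theorem summable_add {x y : ℕ → ℝ} {r s : ℝ} (hr : 0 < r) (hs : 0 < s)
    (hx : Summable fun n => M (|x n| / r)) (hy : Summable fun n => M (|y n| / s)) :
    Summable fun n => M (|x n + y n| / (r + s)) :=
  Summable.of_nonneg_of_le (fun n => M.nonneg_abs_div _ (by positivity))
    (fun n => M.map_add_le (x n) (y n) hr hs) ((hx.mul_left _).add (hy.mul_left _))

theorem abs_mul_div (c a r : ℝ) (hc : c ≠ 0) : |c * a| / (|c| * r) = |a| / r := by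
  rw [abs_mul, mul_div_mul_left _ _ (abs_ne_zero.2 hc)]

/-- The real sequences `x` such that `∑ M (|x n| / r) < ∞` for some `r > 0`. -/
def ellSubmodule : Submodule ℝ (ℕ → ℝ) where
  carrier := {x | ∃ r : ℝ, 0 < r ∧ Summable fun n => M (|x n| / r)}
  zero_mem' := ⟨1, one_pos, by simp [M.map_zero]⟩
  add_mem' := by
    rintro x y ⟨r, hr, hx⟩ ⟨s, hs, hy⟩
    exact ⟨r + s, by positivity, M.summable_add hr hs hx hy⟩
  smul_mem' := by
    rintro c x ⟨r, hr, hx⟩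
    by_cases hc : c = 0
    · exact ⟨1, one_pos, by simp [M.map_zero, hc]⟩
    · refine ⟨|c| * r, by positivity, ?_⟩
      simpa only [Pi.smul_apply, smul_eq_mul, abs_mul_div c _ r hc] using hx

/-- The Orlicz sequence space `ℓ_M`. It is a separate type, so that it carries only the topology of
its norm and not that of pointwise convergence. -/
def ell : Type := M.ellSubmodule

instance : AddCommGroup M.ell := inferInstanceAs (AddCommGroup M.ellSubmodule)

instance : Module ℝ M.ell := inferInstanceAs (Module ℝ M.ellSubmodule)

/-- The `n`-th coordinate of an element of `ℓ_M`. -/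
instance : CoeFun M.ell (fun _ => ℕ → ℝ) := ⟨Subtype.val⟩

/-- The set of all `r > 0` with `∑ M (|x n| / r) ≤ 1` (the sum being finite). -/
def admissible (x : ℕ → ℝ) : Set ℝ :=
  {r | 0 < r ∧ (Summable fun n => M (|x n| / r)) ∧ ∑' n, M (|x n| / r) ≤ 1}

theorem admissible_nonempty (x : M.ell) : (M.admissible x).Nonempty := by
  obtain ⟨r, hr, hx⟩ := x.2
  set S := ∑' n, M (|x.1 n| / r) with hS
  have hS0 : 0 ≤ S := tsum_nonneg fun n => M.nonneg_abs_div _ hr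
  have hc : 1 ≤ S + 1 := by linarith
  have hc0 : 0 < S + 1 := by linarith
  have key : ∀ n, M (|x.1 n| / (r * (S + 1))) ≤ (S + 1)⁻¹ * M (|x.1 n| / r) := fun n => by
    rw [← div_div]
    exact M.map_div_le (by positivity) hc
  have hsum : Summable fun n => M (|x.1 n| / (r * (S + 1))) :=
    Summable.of_nonneg_of_le (fun n => M.nonneg_abs_div _ (by positivity)) key (hx.mul_left _)
  refine ⟨r * (S + 1), by positivity, hsum, ?_⟩
  calc ∑' n, M (|x.1 n| / (r * (S + 1))) ≤ ∑' n, (S + 1)⁻¹ * M (|x.1 n| / r) :=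
        hsum.tsum_le_tsum key (hx.mul_left _)
    _ = (S + 1)⁻¹ * S := by rw [tsum_mul_left]
    _ ≤ 1 := by rw [inv_mul_le_iff₀ hc0]; linarith

theorem admissible_bddBelow (x : ℕ → ℝ) : BddBelow (M.admissible x) :=
  ⟨0, fun _ hr => hr.1.le⟩

theorem admissible_add {x y : ℕ → ℝ} {r s : ℝ} (hr : r ∈ M.admissible x)
    (hs : s ∈ M.admissible y) : r + s ∈ M.admissible (x + y) := by
  obtain ⟨hr, hx, hx1⟩ := hr
  obtain ⟨hs, hy, hy1⟩ := hs
  have hsum := M.summable_add hr hs hx hy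
  refine ⟨by positivity, hsum, ?_⟩
  calc ∑' n, M (|x n + y n| / (r + s))
      ≤ ∑' n, (r / (r + s) * M (|x n| / r) + s / (r + s) * M (|y n| / s)) :=
        hsum.tsum_le_tsum (fun n => M.map_add_le (x n) (y n) hr hs)
          ((hx.mul_left _).add (hy.mul_left _))
    _ = r / (r + s) * ∑' n, M (|x n| / r) + s / (r + s) * ∑' n, M (|y n| / s) := by
        rw [(hx.mul_left _).tsum_add (hy.mul_left _), tsum_mul_left, tsum_mul_left]
    _ ≤ r / (r + s) * 1 + s / (r + s) * 1 := by gcongr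
    _ = 1 := by field_simp

theorem admissible_smul {x : ℕ → ℝ} {r c : ℝ} (hc : c ≠ 0) (hr : r ∈ M.admissible x) :
    |c| * r ∈ M.admissible (c • x) := by
  obtain ⟨hr, hx, hx1⟩ := hr
  refine ⟨by positivity, ?_, ?_⟩ <;>
    simpa only [Pi.smul_apply, smul_eq_mul, abs_mul_div c _ r hc]

/-- The norm of `ℓ_M`: `‖x‖ = inf {r > 0 : ∑ M (|x n| / r) ≤ 1}`. -/
noncomputable instance : Norm M.ell := ⟨fun x => sInf (M.admissible x)⟩

theorem norm_def (x : M.ell) : ‖x‖ = sInf (M.admissible x) := rfl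

theorem norm_nonneg' (x : M.ell) : 0 ≤ ‖x‖ := Real.sInf_nonneg fun _ hr => hr.1.le

theorem norm_zero' : ‖(0 : M.ell)‖ = 0 := by
  refine le_antisymm (le_of_forall_pos_le_add fun e he => ?_) (M.norm_nonneg' 0)
  rw [zero_add]
  refine csInf_le (M.admissible_bddBelow _) ⟨he, ?_, ?_⟩
  · change Summable fun n : ℕ => M (|(0 : ℝ)| / e)
    simp [M.map_zero]
  · change ∑' n : ℕ, M (|(0 : ℝ)| / e) ≤ 1
    simp [M.map_zero]

theorem norm_add_le' (x y : M.ell) : ‖x + y‖ ≤ ‖x‖ + ‖y‖ := by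
  refine le_of_forall_pos_le_add fun e he => ?_
  obtain ⟨r, hr, hr'⟩ := exists_lt_of_csInf_lt (M.admissible_nonempty x)
    (show sInf (M.admissible x) < ‖x‖ + e / 2 by rw [← norm_def]; linarith)
  obtain ⟨s, hs, hs'⟩ := exists_lt_of_csInf_lt (M.admissible_nonempty y)
    (show sInf (M.admissible y) < ‖y‖ + e / 2 by rw [← norm_def]; linarith)
  have h : ‖x + y‖ ≤ r + s := csInf_le (M.admissible_bddBelow _) (M.admissible_add hr hs)
  linarith

theorem norm_smul_le' (c : ℝ) (x : M.ell) : ‖c • x‖ ≤ |c| * ‖x‖ := by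
  by_cases hc : c = 0
  · rw [hc, zero_smul, M.norm_zero', abs_zero, zero_mul]
  · have hc' : 0 < |c| := abs_pos.2 hc
    rw [← div_le_iff₀' hc']
    refine le_csInf (M.admissible_nonempty x) fun r hr => ?_
    rw [div_le_iff₀' hc']
    exact csInf_le (M.admissible_bddBelow _) (M.admissible_smul hc hr)

theorem eq_zero_of_norm_eq_zero' (x : M.ell) (hx : ‖x‖ = 0) : x = 0 := by
  refine Subtype.ext (funext fun n => ?_)
  change x.1 n = 0
  by_contra hn
  have hn' : 0 < |x.1 n| := abs_pos.2 hn
  obtain ⟨T, hT0, hT⟩ : ∃ T : ℝ, 0 < T ∧ ∀ t, T ≤ t → 1 < M t := by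
    obtain ⟨T, hT⟩ := eventually_atTop.1 (M.tendsto_atTop.eventually_gt_atTop 1)
    exact ⟨max T 1, by positivity, fun t ht => hT t ((le_max_left _ _).trans ht)⟩
  obtain ⟨r, ⟨hr, hs, hs1⟩, hr'⟩ := exists_lt_of_csInf_lt (M.admissible_nonempty x)
    (show sInf (M.admissible x) < |x.1 n| / T by rw [← norm_def, hx]; positivity)
  have h1 : M (|x.1 n| / r) ≤ 1 :=
    (hs.le_tsum n fun m _ => M.nonneg_abs_div _ hr).trans hs1
  have h2 : T ≤ |x.1 n| / r := by
    rw [lt_div_iff₀ hT0] at hr'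
    rw [le_div_iff₀ hr]
    linarith
  exact absurd (hT _ h2) (not_lt.2 h1)

noncomputable instance : NormedAddCommGroup M.ell :=
  AddGroupNorm.toNormedAddCommGroup
    { toFun := fun x => ‖x‖
      map_zero' := M.norm_zero'
      add_le' := M.norm_add_le'
      neg' := fun x => by
        have h : ∀ y : M.ell, ‖-y‖ ≤ ‖y‖ := fun y => by
          simpa using M.norm_smul_le' (-1) y
        exact le_antisymm (h x) (by simpa using h (-x))
      eq_zero_of_map_eq_zero' := M.eq_zero_of_norm_eq_zero' }

noncomputable instance : NormedSpace ℝ M.ell where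
  norm_smul_le := M.norm_smul_le'

/-- The subspace `h_M` of `ℓ_M` of all `x` with `∑ M (|x n| / r) < ∞` for every `r > 0`,
with the norm of `ℓ_M`. -/
def hSpace : Submodule ℝ M.ell where
  carrier := {x | ∀ r : ℝ, 0 < r → Summable fun n => M (|x n| / r)}
  zero_mem' := fun r _ => by
    change Summable fun n : ℕ => M (|(0 : ℝ)| / r)
    simp [M.map_zero]
  add_mem' := by
    intro x y hx hy r hr
    have h := M.summable_add (half_pos hr) (half_pos hr) (hx _ (half_pos hr)) (hy _ (half_pos hr))
    rwa [add_halves] at h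
  smul_mem' := by
    intro c x hx r hr
    change Summable fun n : ℕ => M (|c * x.1 n| / r)
    by_cases hc : c = 0
    · simp [M.map_zero, hc]
    · have h := hx (r / |c|) (by positivity)
      have e : ∀ n, |c * x.1 n| / r = |x.1 n| / (r / |c|) := fun n => by
        rw [abs_mul, div_div_eq_mul_div, mul_comm]
      simpa only [e] using h

end OrliczFunction

/-- `f` is a coarse embedding: there are nondecreasing `ρ₁, ρ₂ : [0, ∞) → [0, ∞)` with
`ρ₁ t → ∞` as `t → ∞` and `ρ₁ (d x y) ≤ d (f x) (f y) ≤ ρ₂ (d x y)` for all `x, y`. -/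
def IsCoarseEmbedding {X Y : Type*} [MetricSpace X] [MetricSpace Y] (f : X → Y) : Prop :=
  ∃ ρ₁ ρ₂ : ℝ≥0 → ℝ≥0, Monotone ρ₁ ∧ Monotone ρ₂ ∧ Tendsto ρ₁ atTop atTop ∧
    ∀ x y : X, ρ₁ (nndist x y) ≤ nndist (f x) (f y) ∧ nndist (f x) (f y) ≤ ρ₂ (nndist x y)

/-- `f` is a strong uniform embedding: both a coarse embedding and a uniform embedding (injective,
uniformly continuous, and with uniformly continuous inverse on its range). -/
def IsStrongUniformEmbedding {X Y : Type*} [MetricSpace X] [MetricSpace Y] (f : X → Y) : Prop :=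
  IsCoarseEmbedding f ∧ IsUniformEmbedding f

/-- `X` strongly uniformly embeds into `Y`. -/
def StronglyUniformlyEmbeds (X Y : Type*) [MetricSpace X] [MetricSpace Y] : Prop :=
  ∃ f : X → Y, IsStrongUniformEmbedding f

/-! Maps into `h_N` are estimated through the modular `∑ N |z n|`. If the upper index of `N` is
finite, `N` is doubling on bounded intervals, and for maps with bounded coordinate differences
control of the modular is as good as control of the norm (`exists_hasStrongControl`). On a normed
space even properness comes for free: gluing dilated copies of a map that is controlled at bounded
scale makes far points far (`exists_hasStrongControl_of_bounded_scale`). Three constructions feed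
this scheme.

If `β_M < β_N < ∞`, take `q < p < β_N` with `q` an admissible exponent for `M`. Each coordinate is
recorded by integer translates of a bump at every dyadic scale `2^(-j)`, with weight `M (2^(-j))`.
Measured by `p`-th powers, the total over all scales is at most a constant times `M (min d 1)`,
where `d` is the coordinate difference (`exists_tsum_dyadic_le`), and a single well chosen bump
gives a lower bound. The `p`-th power is imitated in `h_N` by repeating a coordinate many times at a
small height `l`, where `N (l * u) / N l` is at most `u ^ p + ε * u` (`exists_scale`,
`exists_block`).

If `β_M < 2` and `β_N < ∞`, the same construction with target `t ^ 2` reaches Hilbert space.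
Normalized exponential vectors then map Hilbert space into its unit sphere with inner products `exp
(-‖x - y‖²)`, and a Mazur map with `N |Y a| = a ^ 2` carries the sphere into `h_N`
(`exists_hasStrongControl_square`).

If `β_N = ∞`, the exponent `p` may be arbitrarily large, and the repeated blocks span a copy of `c₀`
in `h_N`. An Aharoni type map embeds every separable metric space into `c₀` with distances
comparable to the square root of the metric. -/

open scoped Topology ENNReal

/-! ### Strong uniform embeddings through epsilon-delta conditions -/

/-- Two-sided control of `f` both for large and for small distances. -/
structure HasStrongControl {X Y : Type*} [MetricSpace X] [MetricSpace Y] (f : X → Y) : Prop where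
  bounded : ∀ R : ℝ, ∃ S : ℝ, ∀ x y, dist x y ≤ R → dist (f x) (f y) ≤ S
  proper : ∀ R : ℝ, ∃ S : ℝ, ∀ x y, dist (f x) (f y) ≤ R → dist x y ≤ S
  continuous : ∀ ε : ℝ, 0 < ε → ∃ δ : ℝ, 0 < δ ∧ ∀ x y, dist x y < δ → dist (f x) (f y) < ε
  inverse : ∀ ε : ℝ, 0 < ε → ∃ δ : ℝ, 0 < δ ∧ ∀ x y, dist (f x) (f y) < δ → dist x y < ε

namespace HasStrongControl

variable {X Y Z : Type*} [MetricSpace X] [MetricSpace Y] [MetricSpace Z]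

theorem comp {g : Y → Z} {f : X → Y} (hg : HasStrongControl g) (hf : HasStrongControl f) :
    HasStrongControl (g ∘ f) where
  bounded R := by
    obtain ⟨S, hS⟩ := hf.bounded R
    obtain ⟨S', hS'⟩ := hg.bounded S
    exact ⟨S', fun x y h => hS' _ _ (hS _ _ h)⟩
  proper R := by
    obtain ⟨S, hS⟩ := hg.proper R
    obtain ⟨S', hS'⟩ := hf.proper S
    exact ⟨S', fun x y h => hS' _ _ (hS _ _ h)⟩
  continuous ε hε := by
    obtain ⟨δ, hδ, h⟩ := hg.continuous ε hε
    obtain ⟨δ', hδ', h'⟩ := hf.continuous δ hδ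
    exact ⟨δ', hδ', fun x y hxy => h _ _ (h' _ _ hxy)⟩
  inverse ε hε := by
    obtain ⟨δ, hδ, h⟩ := hf.inverse ε hε
    obtain ⟨δ', hδ', h'⟩ := hg.inverse δ hδ
    exact ⟨δ', hδ', fun x y hxy => h _ _ (h' _ _ hxy)⟩

theorem isUniformEmbedding {f : X → Y} (hf : HasStrongControl f) : IsUniformEmbedding f := by
  refine Metric.isUniformEmbedding_iff.2 ⟨fun x y hxy => ?_, ?_, ?_⟩
  · refine dist_le_zero.1 (le_of_forall_pos_le_add fun ε hε => ?_)
    obtain ⟨δ, hδ, h⟩ := hf.inverse ε hε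
    have := h x y (by rw [hxy, dist_self]; exact hδ)
    linarith
  · refine Metric.uniformContinuous_iff.2 fun ε hε => ?_
    obtain ⟨δ, hδ, h⟩ := hf.continuous ε hε
    exact ⟨δ, hδ, fun x y => h x y⟩
  · intro ε hε
    obtain ⟨δ, hδ, h⟩ := hf.inverse ε hε
    exact ⟨δ, hδ, fun {x y} => h x y⟩

theorem isCoarseEmbedding {f : X → Y} (hf : HasStrongControl f) : IsCoarseEmbedding f := by
  -- The cap `r ≤ t` keeps the supremum finite when no two points are at distance at least `t`.
  let A : ℝ≥0 → Set ℝ≥0 := fun t =>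
    {r | r ≤ t ∧ ∀ x y : X, t ≤ nndist x y → r ≤ nndist (f x) (f y)}
  let B : ℝ≥0 → Set ℝ≥0 := fun t => {r | ∃ x y : X, nndist x y ≤ t ∧ r = nndist (f x) (f y)}
  have hA : ∀ t, BddAbove (A t) := fun t => ⟨t, fun r hr => hr.1⟩
  have hA0 : ∀ t, (A t).Nonempty := fun t => ⟨0, zero_le, fun _ _ _ => zero_le⟩
  have hB : ∀ t, BddAbove (B t) := fun t => by
    obtain ⟨S, hS⟩ := hf.bounded t
    refine ⟨S.toNNReal, ?_⟩
    rintro r ⟨x, y, hxy, rfl⟩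
    refine NNReal.le_toNNReal_of_coe_le ?_
    rw [coe_nndist]
    exact hS x y (by rw [← coe_nndist]; exact_mod_cast hxy)
  refine ⟨fun t => sSup (A t), fun t => sSup (B t), fun s t hst => ?_, fun s t hst => ?_,
    tendsto_atTop.2 fun R => ?_, fun x y => ⟨?_, ?_⟩⟩
  · exact csSup_le_csSup (hA t) (hA0 s)
      fun r hr => ⟨hr.1.trans hst, fun x y h => hr.2 x y (hst.trans h)⟩
  · refine csSup_le' ?_
    rintro r ⟨x, y, hxy, rfl⟩
    exact le_csSup (hB t) ⟨x, y, hxy.trans hst, rfl⟩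
  · obtain ⟨S, hS⟩ := hf.proper R
    refine eventually_atTop.2 ⟨max R (S.toNNReal + 1), fun t ht => le_csSup (hA t)
      ⟨(le_max_left _ _).trans ht, fun x y hxy => ?_⟩⟩
    by_contra! hlt
    have h1 : dist x y ≤ S := hS x y (by rw [← coe_nndist]; exact_mod_cast hlt.le)
    have h2 : S.toNNReal + 1 ≤ nndist x y := (le_max_right _ _).trans (ht.trans hxy)
    have h3 : nndist x y ≤ S.toNNReal :=
      NNReal.le_toNNReal_of_coe_le (by rw [coe_nndist]; exact h1)
    have h4 := h2.trans h3
    exact absurd h4 (not_le.2 (lt_add_one _))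
  · exact csSup_le (hA0 _) fun r hr => hr.2 x y le_rfl
  · exact le_csSup (hB _) ⟨x, y, le_rfl, rfl⟩

theorem stronglyUniformlyEmbeds {f : X → Y} (hf : HasStrongControl f) :
    StronglyUniformlyEmbeds X Y :=
  ⟨f, hf.isCoarseEmbedding, hf.isUniformEmbedding⟩

end HasStrongControl

/-! ### Convexity inequalities, the modular and the norm -/

namespace OrliczFunction

variable (M N : OrliczFunction)

theorem mono {s t : ℝ} (hs : 0 ≤ s) (hst : s ≤ t) : M s ≤ M t :=
  M.monotoneOn (mem_Ici.2 hs) (mem_Ici.2 (hs.trans hst)) hst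

theorem pos {t : ℝ} (ht : 0 < t) : 0 < M t :=
  lt_of_le_of_ne (M.nonneg ht.le) (M.nondegenerate t ht).symm

theorem map_mul_le {t u : ℝ} (ht : 0 ≤ t) (hu : 0 ≤ u) (hu1 : u ≤ 1) : M (t * u) ≤ u * M t := by
  rcases hu.eq_or_lt with rfl | hu0
  · simp [M.map_zero]
  · have h := M.map_div_le (c := u⁻¹) ht ((one_le_inv₀ hu0).2 hu1)
    rwa [inv_inv, div_inv_eq_mul] at h

theorem le_map_mul {t u : ℝ} (ht : 0 ≤ t) (hu : 1 ≤ u) : u * M t ≤ M (t * u) := by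
  have hu0 : 0 < u := by linarith
  have h := M.map_div_le (t := t * u) (c := u) (by positivity) hu
  rw [mul_div_cancel_right₀ _ hu0.ne'] at h
  calc u * M t ≤ u * (u⁻¹ * M (t * u)) := by gcongr
    _ = M (t * u) := by field_simp

theorem strictMono {s t : ℝ} (hs : 0 ≤ s) (hst : s < t) : M s < M t := by
  have ht : 0 < t := hs.trans_lt hst
  have h := M.map_mul_le ht.le (div_nonneg hs ht.le) ((div_le_one ht).2 hst.le)
  rw [mul_div_cancel₀ _ ht.ne'] at h
  refine h.trans_lt ?_
  have := (div_lt_one ht).2 hst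
  have := M.pos ht
  nlinarith

theorem exists_pos_le {w : ℝ} (hw : 0 < w) : ∃ δ : ℝ, 0 < δ ∧ δ ≤ 1 ∧ M δ ≤ w := by
  have h1 := M.pos one_pos
  refine ⟨min 1 (w / M 1), by positivity, min_le_left _ _, ?_⟩
  have h := M.map_mul_le (t := 1) (u := min 1 (w / M 1)) zero_le_one (by positivity)
    (min_le_left _ _)
  rw [one_mul] at h
  refine h.trans ?_
  calc min 1 (w / M 1) * M 1 ≤ w / M 1 * M 1 := by gcongr; exact min_le_right _ _
    _ = w := by field_simp

/-- The modular `∑ M |z i|`. -/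
noncomputable def modular {ι : Type*} (z : ι → ℝ) : ℝ≥0∞ := ∑' i, ENNReal.ofReal (M |z i|)

variable {M N}

theorem modular_le_mul {ι : Type*} {z w : ι → ℝ} {K : ℝ} (hK : 0 ≤ K)
    (h : ∀ i, M |z i| ≤ K * N |w i|) : M.modular z ≤ ENNReal.ofReal K * N.modular w := by
  unfold modular
  rw [← ENNReal.tsum_mul_left]
  refine ENNReal.tsum_le_tsum fun i => ?_
  rw [← ENNReal.ofReal_mul hK]
  exact ENNReal.ofReal_le_ofReal (h i)

theorem modular_mono {ι : Type*} {z w : ι → ℝ} (h : ∀ i, |z i| ≤ |w i|) :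
    M.modular z ≤ M.modular w :=
  ENNReal.tsum_le_tsum fun i => ENNReal.ofReal_le_ofReal (M.mono (abs_nonneg _) (h i))

theorem le_of_modular_le {ι : Type*} {z : ι → ℝ} {e : ℝ} (he : 0 ≤ e)
    (h : M.modular z ≤ ENNReal.ofReal e) (i : ι) : M |z i| ≤ e :=
  (ENNReal.ofReal_le_ofReal_iff he).1 ((ENNReal.le_tsum i).trans h)

theorem abs_le_of_modular_le {ι : Type*} {z : ι → ℝ} {e : ℝ} (he : 0 ≤ e)
    (h : M.modular z ≤ ENNReal.ofReal (M e)) (i : ι) : |z i| ≤ e := by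
  by_contra! hlt
  exact absurd (le_of_modular_le (M.nonneg he) h i) (not_le.2 (M.strictMono he hlt))

theorem summable_of_modular_ne_top {ι : Type*} {z : ι → ℝ} (h : M.modular z ≠ ⊤) :
    Summable fun i => M |z i| := by
  have := ENNReal.summable_toReal h
  simpa only [ENNReal.toReal_ofReal (M.nonneg (abs_nonneg _))] using this

theorem mem_admissible_iff {x : ℕ → ℝ} {r : ℝ} (hr : 0 < r) :
    r ∈ M.admissible x ↔ M.modular (fun n => x n / r) ≤ 1 := by
  have e : ∀ n, |x n / r| = |x n| / r := fun n => by rw [abs_div, abs_of_pos hr]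
  have hn : ∀ n, 0 ≤ M (|x n| / r) := fun n => M.nonneg_abs_div _ hr
  constructor
  · rintro ⟨-, hs, h1⟩
    simp only [modular, e]
    rw [← ENNReal.ofReal_tsum_of_nonneg hn hs]
    exact ENNReal.ofReal_le_one.2 h1
  · intro h
    have hs := summable_of_modular_ne_top (ne_top_of_le_ne_top ENNReal.one_ne_top h)
    simp only [modular, e] at h hs
    rw [← ENNReal.ofReal_tsum_of_nonneg hn hs] at h
    exact ⟨hr, hs, ENNReal.ofReal_le_one.1 h⟩

theorem norm_le_of_modular_div_le_one {x : M.hSpace} {r : ℝ} (hr : 0 < r)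
    (h : M.modular (fun n => x.1 n / r) ≤ 1) : ‖x‖ ≤ r :=
  csInf_le (M.admissible_bddBelow _) ((mem_admissible_iff hr).2 h)

theorem modular_div_le_one_of_norm_lt {x : M.hSpace} {r : ℝ} (h : ‖x‖ < r) :
    M.modular (fun n => x.1 n / r) ≤ 1 := by
  obtain ⟨s, hs, hsr⟩ := exists_lt_of_csInf_lt (M.admissible_nonempty x.1) h
  have hs0 : 0 < s := hs.1
  refine (modular_mono fun n => ?_).trans ((mem_admissible_iff hs0).1 hs)
  rw [abs_div, abs_div, abs_of_pos hs0, abs_of_pos (hs0.trans hsr)]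
  gcongr

/-- Convexity alone gives this comparison, like its counterpart `norm_le_of_modular_le`; the reverse
comparisons need doubling. -/
theorem modular_le_of_norm_lt {x : M.hSpace} {r : ℝ} (hr : r ≤ 1) (h : ‖x‖ < r) :
    M.modular x.1 ≤ ENNReal.ofReal r := by
  have hr0 : 0 < r := (norm_nonneg x).trans_lt h
  refine (modular_le_mul hr0.le fun n => ?_).trans
    (mul_le_of_le_one_right' (modular_div_le_one_of_norm_lt h))
  have := M.map_mul_le (t := |x.1 n / r|) (abs_nonneg _) hr0.le hr
  rwa [abs_div, abs_of_pos hr0, div_mul_cancel₀ _ hr0.ne', ← abs_of_pos hr0, ← abs_div,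
    abs_of_pos hr0] at this

theorem norm_le_of_modular_le {x : M.hSpace} {r : ℝ} (hr : 1 ≤ r)
    (h : M.modular x.1 ≤ ENNReal.ofReal r) : ‖x‖ ≤ r := by
  have hr0 : 0 < r := by linarith
  refine norm_le_of_modular_div_le_one hr0 ?_
  calc M.modular (fun n => x.1 n / r) ≤ ENNReal.ofReal r⁻¹ * M.modular x.1 :=
        modular_le_mul (by positivity) fun n => by
          rw [abs_div, abs_of_pos hr0]
          exact M.map_div_le (abs_nonneg _) hr
    _ ≤ ENNReal.ofReal r⁻¹ * ENNReal.ofReal r := by gcongr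
    _ = 1 := by rw [← ENNReal.ofReal_mul (by positivity), inv_mul_cancel₀ hr0.ne',
        ENNReal.ofReal_one]

theorem modular_extend {ι κ : Type*} {e : ι → κ} (he : Function.Injective e) (z : ι → ℝ) :
    M.modular (Function.extend e z 0) = M.modular z := by
  unfold modular
  rw [← tsum_extend_zero he]
  refine tsum_congr fun k => ?_
  by_cases hk : ∃ i, e i = k
  · obtain ⟨i, rfl⟩ := hk
    rw [he.extend_apply, he.extend_apply]
  · rw [Function.extend_apply' _ _ _ hk, Function.extend_apply' _ _ _ hk]
    simp [M.map_zero]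

/-- An element of `h_M` from a sequence all of whose multiples have finite modular. -/
def mkH (z : ℕ → ℝ) (h : ∀ r : ℝ, 0 < r → M.modular (fun n => z n / r) ≠ ⊤) : M.hSpace :=
  have hs : ∀ r : ℝ, 0 < r → Summable fun n => M (|z n| / r) := fun r hr => by
    have := summable_of_modular_ne_top (h r hr)
    simpa only [abs_div, abs_of_pos hr] using this
  ⟨⟨z, 1, one_pos, hs 1 one_pos⟩, hs⟩

/-! ### Doubling and the upper index -/

/-- Doubling on bounded intervals. -/
def IsDoubling (M : OrliczFunction) : Prop :=
  ∀ R T : ℝ, 1 ≤ R → ∃ K : ℝ, 1 ≤ K ∧ ∀ t : ℝ, 0 ≤ t → t ≤ T → M (R * t) ≤ K * M t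

theorem le_mul_of_mem_index_set {q : ℝ} (h : ∃ c : ℝ, 0 < c ∧
    ∀ l ∈ Ioc (0 : ℝ) 1, ∀ t ∈ Ioc (0 : ℝ) 1, c ≤ M (l * t) / (M l * t ^ q)) :
    ∃ c : ℝ, 0 < c ∧ ∀ l t : ℝ, 0 < l → l ≤ 1 → 0 < t → t ≤ 1 →
      c * (M l * t ^ q) ≤ M (l * t) := by
  obtain ⟨c, hc, h⟩ := h
  refine ⟨c, hc, fun l t hl hl1 ht ht1 => ?_⟩
  have hp : 0 < M l * t ^ q := mul_pos (M.pos hl) (Real.rpow_pos_of_pos ht _)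
  exact (le_div_iff₀ hp).1 (h l ⟨hl, hl1⟩ t ⟨ht, ht1⟩)

theorem exists_of_upperIndex_lt {b : EReal} (h : M.upperIndex < b) :
    ∃ q : ℝ, (q : EReal) < b ∧ ∃ c : ℝ, 0 < c ∧ ∀ l t : ℝ, 0 < l → l ≤ 1 → 0 < t → t ≤ 1 →
      c * (M l * t ^ q) ≤ M (l * t) := by
  obtain ⟨_, ⟨q, hq, rfl⟩, hb⟩ := sInf_lt_iff.1 h
  exact ⟨q, hb, le_mul_of_mem_index_set hq⟩

theorem isDoubling_of_upperIndex_lt_top (h : M.upperIndex < ⊤) : M.IsDoubling := by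
  obtain ⟨q, -, c, hc, hq⟩ := exists_of_upperIndex_lt h
  intro R T hR
  have hR0 : 0 < R := by linarith
  have hRq : 0 < R⁻¹ ^ q := Real.rpow_pos_of_pos (by positivity) _
  have hM := M.pos (inv_pos.2 hR0)
  have hT : 0 ≤ M (R * max T 0) := M.nonneg (by positivity)
  -- The second term serves `R * t ≤ 1`, by the index inequality at `l = R * t` with ratio `R⁻¹`.
  -- The third serves `R * t ≥ 1`, where `M t` is at least `M R⁻¹`.
  refine ⟨1 + (c * R⁻¹ ^ q)⁻¹ + M (R * max T 0) / M R⁻¹, ?_, fun t ht htT => ?_⟩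
  · have : 0 ≤ (c * R⁻¹ ^ q)⁻¹ := by positivity
    have : 0 ≤ M (R * max T 0) / M R⁻¹ := by positivity
    linarith
  have h0 : 0 ≤ M t := M.nonneg ht
  rcases ht.eq_or_lt with rfl | ht0
  · simp [M.map_zero]
  rcases le_total (R * t) 1 with h1 | h1
  · have h2 := hq (R * t) R⁻¹ (by positivity) h1 (by positivity) (inv_le_one_of_one_le₀ hR)
    rw [mul_comm R t, mul_inv_cancel_right₀ hR0.ne', mul_comm t R] at h2
    have h3 : M (R * t) ≤ (c * R⁻¹ ^ q)⁻¹ * M t := by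
      rw [← div_eq_inv_mul, le_div_iff₀ (by positivity)]
      linarith
    have : 0 ≤ M (R * max T 0) / M R⁻¹ * M t := by positivity
    nlinarith
  · have h2 : M R⁻¹ ≤ M t := M.mono (by positivity) ((inv_le_iff_one_le_mul₀' hR0).2 h1)
    have h3 : M (R * t) ≤ M (R * max T 0) :=
      M.mono (by positivity) (by gcongr; exact htT.trans (le_max_left _ _))
    have h4 : M (R * max T 0) ≤ M (R * max T 0) / M R⁻¹ * M t := by
      rw [div_mul_eq_mul_div, le_div_iff₀ hM]
      gcongr
    have : 0 ≤ (c * R⁻¹ ^ q)⁻¹ * M t := by positivity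
    nlinarith

/-- Below the upper index there are arbitrarily small scales at which `M` is almost bounded by a
power. -/
theorem exists_scale {p : ℝ} (hp : 1 ≤ p) (h : (p : EReal) < M.upperIndex) {ε δ : ℝ} (hε : 0 < ε)
    (hδ : 0 < δ) : ∃ l : ℝ, 0 < l ∧ l ≤ δ ∧ l ≤ 1 ∧
      ∀ u : ℝ, 0 ≤ u → u ≤ 1 → M (l * u) ≤ M l * (u ^ p + ε * u) := by
  set d := min δ 1 with hd
  have hd0 : 0 < d := by positivity
  have hd1 : d ≤ 1 := min_le_right _ _
  -- Otherwise `p` would be an admissible exponent, contradicting `p < β_M`. The factor `M d / M 1`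
  -- in the constant takes care of `l` between `d` and `1`.
  obtain ⟨l, t, hl, hld, ht, ht1, hlt⟩ : ∃ l t : ℝ, 0 < l ∧ l ≤ d ∧ 0 < t ∧ t ≤ 1 ∧
      M (l * t) < ε * (M l * t ^ p) := by
    by_contra! hcon
    refine absurd (sInf_le (mem_image_of_mem _ (?_ : p ∈ _))) (not_le.2 h)
    have hMd := M.pos hd0
    have hM1 := M.pos one_pos
    have hr : M d / M 1 ≤ 1 := (div_le_one hM1).2 (M.mono hd0.le hd1)
    refine ⟨ε * (M d / M 1), by positivity, fun l hl t ht => ?_⟩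
    have hMl := M.pos hl.1
    have htp : 0 < t ^ p := Real.rpow_pos_of_pos ht.1 _
    rw [le_div_iff₀ (mul_pos hMl htp)]
    rcases le_total l d with hld | hld
    · refine le_trans ?_ (hcon l t hl.1 hld ht.1 ht.2)
      gcongr
      exact mul_le_of_le_one_right hε.le hr
    · have h1 : M l ≤ M 1 := M.mono hl.1.le hl.2
      have h2 : M (d * t) ≤ M (l * t) := M.mono (by have := ht.1; positivity)
        (by have := ht.1; gcongr)
      refine le_trans ?_ ((hcon d t hd0 le_rfl ht.1 ht.2).trans h2)
      have : M d / M 1 * M l ≤ M d := by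
        rw [div_mul_eq_mul_div, div_le_iff₀ hM1]
        gcongr
      calc ε * (M d / M 1) * (M l * t ^ p) = ε * ((M d / M 1 * M l) * t ^ p) := by ring
        _ ≤ ε * (M d * t ^ p) := by gcongr
  have hlt0 : 0 < l * t := by positivity
  have hltl : l * t ≤ l := mul_le_of_le_one_right hl.le ht1
  -- The sought scale maximizes `M s / s ^ p` on `[l * t, l]`, so the pure power bound relative to
  -- `s` holds as long as the argument stays in this interval.
  obtain ⟨s, ⟨hs1, hs2⟩, hmax⟩ := isCompact_Icc.exists_isMaxOn (nonempty_Icc.2 hltl)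
    (f := fun s => M s / s ^ p) (by
      refine ContinuousOn.div (M.continuousOn.mono fun s hs => hlt0.le.trans hs.1) ?_ ?_
      · exact (Real.continuous_rpow_const (by linarith)).continuousOn
      · exact fun s hs => (Real.rpow_pos_of_pos (hlt0.trans_le hs.1) _).ne')
  have hs0 : 0 < s := hlt0.trans_le hs1
  have hmax' : ∀ v, l * t ≤ v → v ≤ l → M v ≤ M s * (v / s) ^ p := fun v h1 h2 => by
    have hv0 : 0 < v := hlt0.trans_le h1
    have h3 : M v / v ^ p ≤ M s / s ^ p := hmax ⟨h1, h2⟩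
    rw [div_le_iff₀ (Real.rpow_pos_of_pos hv0 _)] at h3
    rw [Real.div_rpow hv0.le hs0.le]
    calc M v ≤ _ := h3
      _ = _ := by ring
  have hsd : s ≤ d := hs2.trans hld
  refine ⟨s, hs0, hsd.trans (min_le_left _ _), hsd.trans hd1, fun u hu hu1 => ?_⟩
  have hMs := M.pos hs0
  have hsu : s * u ≤ l := (mul_le_of_le_one_right hs0.le hu1).trans hs2
  rcases le_total (l * t) (s * u) with h1 | h1
  · have h2 := hmax' _ h1 hsu
    rw [mul_div_cancel_left₀ _ hs0.ne'] at h2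
    refine h2.trans ?_
    gcongr
    have : 0 ≤ ε * u := by positivity
    linarith
  -- Below `l * t` convexity makes `M` sublinear, with slope governed by `M (l * t)`. That value is
  -- small by the choice of `t`, and `p ≥ 1` turns the bound into `ε * u`.
  · have h2 := M.map_mul_le (t := l * t) (u := s * u / (l * t)) hlt0.le (by positivity)
      ((div_le_one hlt0).2 h1)
    rw [mul_div_cancel₀ _ hlt0.ne'] at h2
    have h3 : M (l * t) ≤ ε * (M s * (l * t / s) ^ p) := by
      refine hlt.le.trans ?_
      have := hmax' l hltl le_rfl
      calc ε * (M l * t ^ p) ≤ ε * ((M s * (l / s) ^ p) * t ^ p) := by gcongr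
        _ = ε * (M s * (l * t / s) ^ p) := by
          rw [mul_assoc, ← Real.mul_rpow (by positivity) ht.le, div_mul_eq_mul_div]
    have h4 : (l * t / s) ^ p ≤ l * t / s := by
      have := Real.rpow_le_rpow_of_exponent_ge (x := l * t / s) (by positivity)
        ((div_le_one hs0).2 hs1) hp
      rwa [Real.rpow_one] at this
    have h5 : 0 ≤ u ^ p := Real.rpow_nonneg hu _
    calc M (s * u) ≤ s * u / (l * t) * M (l * t) := h2
      _ ≤ s * u / (l * t) * (ε * (M s * (l * t / s))) := by
        gcongr
        exact h3.trans (by gcongr)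
      _ = M s * (ε * u) := by field_simp
      _ ≤ M s * (u ^ p + ε * u) := by gcongr; linarith

end OrliczFunction

/-! ### From modular control to norm control -/

namespace OrliczFunction

variable {M N : OrliczFunction}

/-- Doubling is uniform only on `[0, T]`, hence the coordinate bound. This is what lets modular and
norm be exchanged for maps with bounded coordinate differences. -/
theorem IsDoubling.exists_modular_le (hN : N.IsDoubling) (T : ℝ) {r : ℝ} (hr : 0 < r) :
    ∃ K : ℝ, 1 ≤ K ∧ ∀ {ι : Type} (z : ι → ℝ), (∀ i, |z i| ≤ T) →
      N.modular (fun i => z i / r) ≤ ENNReal.ofReal K * N.modular z := by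
  obtain ⟨K, hK, h⟩ := hN (max 1 r⁻¹) T (le_max_left _ _)
  refine ⟨K, hK, fun z hz => modular_le_mul (by linarith) fun i => ?_⟩
  refine le_trans (N.mono (abs_nonneg _) ?_) (h _ (abs_nonneg _) (hz i))
  rw [abs_div, abs_of_pos hr, div_eq_inv_mul]
  gcongr
  exact le_max_right _ _

theorem IsDoubling.exists_norm_le (hN : N.IsDoubling) (T : ℝ) {ε : ℝ} (hε : 0 < ε) :
    ∃ η : ℝ, 0 < η ∧ ∀ z : N.hSpace, (∀ n, |z.1 n| ≤ T) →
      N.modular z.1 ≤ ENNReal.ofReal η → ‖z‖ ≤ ε := by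
  obtain ⟨K, hK, h⟩ := hN.exists_modular_le T hε
  have hK0 : 0 < K := by linarith
  refine ⟨K⁻¹, by positivity, fun z hz hle => norm_le_of_modular_div_le_one hε ?_⟩
  calc N.modular (fun n => z.1 n / ε) ≤ ENNReal.ofReal K * N.modular z.1 := h _ hz
    _ ≤ ENNReal.ofReal K * ENNReal.ofReal K⁻¹ := by gcongr
    _ = 1 := by rw [← ENNReal.ofReal_mul hK0.le, mul_inv_cancel₀ hK0.ne', ENNReal.ofReal_one]

theorem IsDoubling.exists_modular_le_of_norm_le (hN : N.IsDoubling) (T R : ℝ) :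
    ∃ B : ℝ, 0 ≤ B ∧ ∀ z : N.hSpace, (∀ n, |z.1 n| ≤ T) → ‖z‖ ≤ R →
      N.modular z.1 ≤ ENNReal.ofReal B := by
  set R' := max R 0 + 1
  have hR' : 0 < R' := by positivity
  obtain ⟨K, hK, h⟩ := hN.exists_modular_le (T / R') (inv_pos.2 hR')
  refine ⟨K, by linarith, fun z hz hle => ?_⟩
  have h1 := h (fun n => z.1 n / R') fun n => by
    rw [abs_div, abs_of_pos hR']
    have := hz n
    gcongr
  have h2 : (fun n => z.1 n / R' / R'⁻¹) = z.1.1 := by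
    funext n
    field_simp
  rw [h2] at h1
  refine h1.trans (mul_le_of_le_one_right' (modular_div_le_one_of_norm_lt ?_))
  have := le_max_left R 0
  simp only [R']
  linarith

/-- A map into sequences that is controlled by the modular of `N` gives a controlled map into
`h_N`. -/
theorem exists_hasStrongControl {X : Type*} [MetricSpace X] [Nonempty X] {ι : Type} [Countable ι]
    (hN : N.IsDoubling) (Φ : X → ι → ℝ) (T : ℝ) (hT : ∀ x y a, |Φ x a - Φ y a| ≤ T)
    (bounded : ∀ S : ℝ, ∃ B : ℝ, ∀ x y, dist x y ≤ S →
      N.modular (Φ x - Φ y) ≤ ENNReal.ofReal B)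
    (proper : ∀ B : ℝ, 0 ≤ B → ∃ S : ℝ, ∀ x y,
      N.modular (Φ x - Φ y) ≤ ENNReal.ofReal B → dist x y ≤ S)
    (continuous : ∀ ε : ℝ, 0 < ε → ∃ δ : ℝ, 0 < δ ∧ ∀ x y, dist x y < δ →
      N.modular (Φ x - Φ y) ≤ ENNReal.ofReal ε)
    (inverse : ∀ ε : ℝ, 0 < ε → ∃ η : ℝ, 0 < η ∧ ∀ x y,
      N.modular (Φ x - Φ y) ≤ ENNReal.ofReal η → dist x y < ε) :
    ∃ f : X → N.hSpace, HasStrongControl f := by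
  obtain ⟨e, he⟩ := exists_injective_nat ι
  obtain ⟨x₀⟩ := ‹Nonempty X›
  -- Only differences of values of `Φ` are known to have finite modular, so a base point is
  -- subtracted.
  let z : X → ℕ → ℝ := fun x => Function.extend e (Φ x - Φ x₀) 0
  have hz_sub : ∀ x y, z x - z y = Function.extend e (Φ x - Φ y) 0 := fun x y => by
    funext k
    by_cases hk : ∃ i, e i = k
    · obtain ⟨i, rfl⟩ := hk
      simp [z, he.extend_apply]
    · simp [z, Function.extend_apply' _ _ _ hk]
  have hT0 : ∀ x y k, |(z x - z y) k| ≤ max T 0 := fun x y k => by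
    rw [hz_sub]
    by_cases hk : ∃ i, e i = k
    · obtain ⟨i, rfl⟩ := hk
      rw [he.extend_apply]
      exact (hT x y i).trans (le_max_left _ _)
    · simp [Function.extend_apply' _ _ _ hk]
  have hmod : ∀ x y, N.modular (z x - z y) = N.modular (Φ x - Φ y) := fun x y => by
    rw [hz_sub, modular_extend he]
  have hz0 : z x₀ = 0 := by
    funext k
    by_cases hk : ∃ i, e i = k
    · obtain ⟨i, rfl⟩ := hk
      simp [z, he.extend_apply]
    · simp [z, Function.extend_apply' _ _ _ hk]
  have hfin : ∀ x (r : ℝ), 0 < r → N.modular (fun n => z x n / r) ≠ ⊤ := fun x r hr => by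
    obtain ⟨K, -, h⟩ := hN.exists_modular_le (max T 0) hr
    obtain ⟨B, hB⟩ := bounded (dist x x₀)
    have h1 := hB x x₀ le_rfl
    rw [← hmod, hz0, sub_zero] at h1
    refine ne_top_of_le_ne_top ?_ (h (z x) fun k => by simpa [hz0] using hT0 x x₀ k)
    exact ENNReal.mul_ne_top ENNReal.ofReal_ne_top (ne_top_of_le_ne_top ENNReal.ofReal_ne_top h1)
  let f : X → N.hSpace := fun x => mkH (z x) (hfin x)
  have hf : ∀ x y, (f x - f y).1.1 = z x - z y := fun x y => rfl
  have hfT : ∀ x y n, |(f x - f y).1 n| ≤ max T 0 := fun x y n => by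
    rw [hf]
    exact hT0 x y n
  have hfm : ∀ x y, N.modular (f x - f y).1.1 = N.modular (Φ x - Φ y) := fun x y => by
    rw [hf, hmod]
  refine ⟨f, ⟨fun R => ?_, fun R => ?_, fun ε hε => ?_, fun ε hε => ?_⟩⟩
  · obtain ⟨B, hB⟩ := bounded R
    refine ⟨max 1 B, fun x y hxy => ?_⟩
    rw [dist_eq_norm]
    refine norm_le_of_modular_le (le_max_left _ _) ?_
    rw [hfm]
    exact (hB x y hxy).trans (ENNReal.ofReal_le_ofReal (le_max_right _ _))
  · obtain ⟨B, hB0, hB⟩ := hN.exists_modular_le_of_norm_le (max T 0) R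
    obtain ⟨S, hS⟩ := proper B hB0
    refine ⟨S, fun x y hxy => hS x y ?_⟩
    rw [← hfm]
    exact hB _ (hfT x y) (by rwa [← dist_eq_norm])
  · obtain ⟨η, hη, h⟩ := hN.exists_norm_le (max T 0) (half_pos hε)
    obtain ⟨δ, hδ, h'⟩ := continuous η hη
    refine ⟨δ, hδ, fun x y hxy => ?_⟩
    rw [dist_eq_norm]
    have := h (f x - f y) (hfT x y) (by rw [hfm]; exact h' x y hxy)
    linarith
  · obtain ⟨η, hη, h⟩ := inverse ε hε
    refine ⟨min η 1, by positivity, fun x y hxy => h x y ?_⟩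
    rw [dist_eq_norm] at hxy
    rw [← hfm]
    exact (modular_le_of_norm_lt (min_le_right _ _) hxy).trans
      (ENNReal.ofReal_le_ofReal (min_le_left _ _))

theorem modular_sigma {ι : Type*} {κ : ι → Type*} (z : (Σ i, κ i) → ℝ) :
    N.modular z = ∑' i, N.modular (fun k => z ⟨i, k⟩) := by
  unfold modular
  rw [ENNReal.tsum_sigma']

theorem tsum_half_pow : ∑' i : ℕ, ENNReal.ofReal ((1 / 2 : ℝ) ^ i) = 2 := by
  rw [← ENNReal.ofReal_tsum_of_nonneg (fun i => by positivity) summable_geometric_two,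
    tsum_geometric_two]
  simp

theorem tsum_le_of_head_tail {t : ℕ → ℝ≥0∞} (k : ℕ) {a b : ℝ} (ha : 0 ≤ a) (hb : 0 ≤ b)
    (head : ∀ i < k, t i ≤ ENNReal.ofReal a)
    (tail : ∀ i, t (i + k) ≤ ENNReal.ofReal (b * (1 / 2) ^ i)) :
    ∑' i, t i ≤ ENNReal.ofReal (k * a + 2 * b) := by
  rw [← ENNReal.summable.sum_add_tsum_nat_add' (f := t) (k := k),
    ENNReal.ofReal_add (by positivity) (by positivity)]
  refine add_le_add ?_ ?_
  · calc ∑ i ∈ Finset.range k, t i ≤ ∑ i ∈ Finset.range k, ENNReal.ofReal a :=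
          Finset.sum_le_sum fun i hi => head i (Finset.mem_range.1 hi)
      _ = ENNReal.ofReal (k * a) := by
          rw [Finset.sum_const, Finset.card_range, nsmul_eq_mul,
            ENNReal.ofReal_mul (by positivity), ENNReal.ofReal_natCast]
  · calc ∑' i, t (i + k) ≤ ∑' i : ℕ, ENNReal.ofReal (b * (1 / 2) ^ i) := ENNReal.tsum_le_tsum tail
      _ = ENNReal.ofReal (2 * b) := by
          simp_rw [ENNReal.ofReal_mul hb]
          rw [ENNReal.tsum_mul_left, tsum_half_pow, ENNReal.ofReal_mul two_pos.le, mul_comm]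
          simp

/-- On a normed space it suffices to control the modular at bounded scale: the coarse behaviour
is recovered by gluing dilations. -/
theorem exists_hasStrongControl_of_bounded_scale {E : Type*} [NormedAddCommGroup E]
    [NormedSpace ℝ E] {ι : Type} [Countable ι]
    (hN : N.IsDoubling) (Φ : E → ι → ℝ) (T : ℝ) (hT : ∀ x y a, |Φ x a - Φ y a| ≤ T)
    (bounded : ∀ S : ℝ, ∃ B : ℝ, 0 ≤ B ∧ ∀ x y, ‖x - y‖ ≤ S →
      N.modular (Φ x - Φ y) ≤ ENNReal.ofReal B)
    (continuous : ∀ ε : ℝ, 0 < ε → ∃ δ : ℝ, 0 < δ ∧ ∀ x y, ‖x - y‖ < δ →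
      N.modular (Φ x - Φ y) ≤ ENNReal.ofReal ε)
    (inverse : ∀ ε : ℝ, 0 < ε → ∃ η : ℝ, 0 < η ∧ ∀ x y,
      N.modular (Φ x - Φ y) ≤ ENNReal.ofReal η → ‖x - y‖ < ε) :
    ∃ f : E → N.hSpace, HasStrongControl f := by
  choose δ hδ0 hδ using fun i : ℕ => continuous ((1 / 2) ^ i) (by positivity)
  -- Dividing by `R i` brings points at distance less than `i + 1` within `δ i`, so the `i`-th copy
  -- contributes at most `2^(-i)`. The bound `1 ≤ R i` makes the dilations contractions.
  let R : ℕ → ℝ := fun i => max 1 (((i : ℝ) + 1) / δ i)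
  have hR1 : ∀ i, 1 ≤ R i := fun i => le_max_left _ _
  have hR0 : ∀ i, 0 < R i := fun i => one_pos.trans_le (hR1 i)
  have hRn : ∀ i (x y : E), ‖(R i)⁻¹ • x - (R i)⁻¹ • y‖ = ‖x - y‖ / R i := fun i x y => by
    rw [← smul_sub, norm_smul, Real.norm_of_nonneg (inv_nonneg.2 (hR0 i).le), div_eq_inv_mul]
  have hRle : ∀ i (x y : E), ‖(R i)⁻¹ • x - (R i)⁻¹ • y‖ ≤ ‖x - y‖ := fun i x y => by
    rw [hRn]
    exact div_le_self (norm_nonneg _) (hR1 i)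
  let Ψ : E → (Σ _ : ℕ, ι) → ℝ := fun x a => Φ ((R a.1)⁻¹ • x) a.2
  let t : E → E → ℕ → ℝ≥0∞ := fun x y i => N.modular (Φ ((R i)⁻¹ • x) - Φ ((R i)⁻¹ • y))
  have hΨ : ∀ x y, N.modular (Ψ x - Ψ y) = ∑' i, t x y i := fun x y => modular_sigma _
  have ht : ∀ (x y : E) (i : ℕ), ‖x - y‖ < i + 1 → t x y i ≤ ENNReal.ofReal ((1 / 2) ^ i) := by
    intro x y i hxy
    refine hδ i _ _ ?_
    rw [hRn, div_lt_iff₀ (hR0 i)]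
    refine hxy.trans_le ?_
    calc (i : ℝ) + 1 = δ i * (((i : ℝ) + 1) / δ i) := by have := hδ0 i; field_simp
      _ ≤ δ i * R i := by have := (hδ0 i).le; gcongr; exact le_max_right _ _
  refine exists_hasStrongControl hN Ψ T (fun x y a => hT _ _ _) (fun S => ?_) (fun B hB => ?_)
    (fun ε hε => ?_) (fun ε hε => ?_)
  · obtain ⟨B, hB0, hB⟩ := bounded S
    obtain ⟨k, hk⟩ := exists_nat_gt S
    refine ⟨k * B + 2, fun x y hxy => ?_⟩
    rw [dist_eq_norm] at hxy
    rw [hΨ, show (k * B + 2 : ℝ) = k * B + 2 * 1 by ring]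
    refine tsum_le_of_head_tail k hB0 zero_le_one
      (fun i _ => hB _ _ ((hRle i x y).trans hxy)) fun i => (ht x y (i + k) ?_).trans
        (ENNReal.ofReal_le_ofReal ?_)
    · push_cast
      have : (0 : ℝ) ≤ i := i.cast_nonneg
      linarith
    · rw [one_mul]
      exact pow_le_pow_of_le_one (by norm_num) (by norm_num) (Nat.le_add_right _ _)
  · obtain ⟨η, hη, h⟩ := inverse 1 one_pos
    obtain ⟨k, hk⟩ := exists_nat_gt (B / η)
    -- Beyond this distance each of the first `k` copies still sees points at distance at least `1`
    -- and contributes at least `η`, while `k * η > B`.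
    refine ⟨∑ i ∈ Finset.range k, R i, fun x y hxy => ?_⟩
    rw [dist_eq_norm]
    by_contra! hlt
    have h1 : ∀ i ∈ Finset.range k, ENNReal.ofReal η ≤ t x y i := fun i hi => by
      by_contra! hcon
      have h2 := h _ _ hcon.le
      rw [hRn, div_lt_one (hR0 i)] at h2
      have h3 : R i ≤ ∑ i ∈ Finset.range k, R i :=
        Finset.single_le_sum (f := R) (fun i _ => (hR0 i).le) hi
      linarith
    have h2 : ENNReal.ofReal (k * η) ≤ ENNReal.ofReal B := by
      calc ENNReal.ofReal (k * η) = ∑ i ∈ Finset.range k, ENNReal.ofReal η := by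
            rw [Finset.sum_const, Finset.card_range, nsmul_eq_mul,
              ENNReal.ofReal_mul (by positivity), ENNReal.ofReal_natCast]
        _ ≤ ∑ i ∈ Finset.range k, t x y i := Finset.sum_le_sum h1
        _ ≤ ∑' i, t x y i := ENNReal.sum_le_tsum _
        _ ≤ ENNReal.ofReal B := by rw [← hΨ]; exact hxy
    rw [div_lt_iff₀ hη] at hk
    exact absurd ((ENNReal.ofReal_le_ofReal_iff hB).1 h2) (not_le.2 hk)
  · obtain ⟨k, hk⟩ := exists_pow_lt_of_lt_one (show 0 < ε / 4 by positivity)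
      (show (1 / 2 : ℝ) < 1 by norm_num)
    obtain ⟨d, hd, h⟩ := continuous (ε / (2 * (k + 1))) (by positivity)
    refine ⟨min d 1, by positivity, fun x y hxy => ?_⟩
    rw [dist_eq_norm] at hxy
    have hxd := hxy.trans_le (min_le_left _ _)
    have hx1 := hxy.trans_le (min_le_right _ _)
    rw [hΨ]
    refine (tsum_le_of_head_tail k (a := ε / (2 * (k + 1))) (b := ε / 4) (by positivity)
      (by positivity) (fun i _ => h _ _ ((hRle i x y).trans_lt hxd)) fun i =>
        (ht x y (i + k) ?_).trans (ENNReal.ofReal_le_ofReal ?_)).trans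
      (ENNReal.ofReal_le_ofReal ?_)
    · push_cast
      have : (0 : ℝ) ≤ i := i.cast_nonneg
      have : (0 : ℝ) ≤ k := k.cast_nonneg
      linarith
    · rw [pow_add, mul_comm]
      gcongr
    · have h1 : k * (ε / (2 * (k + 1))) ≤ ε / 2 := by
        rw [← mul_div_assoc, div_le_div_iff₀ (by positivity) (by positivity)]
        nlinarith
      linarith
  · obtain ⟨η, hη, h⟩ := inverse (ε / R 0) (div_pos hε (hR0 0))
    refine ⟨η, hη, fun x y hxy => ?_⟩
    rw [dist_eq_norm]
    rw [hΨ] at hxy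
    have h2 := h _ _ ((ENNReal.le_tsum 0).trans hxy)
    rwa [hRn, div_lt_div_iff_of_pos_right (hR0 0)] at h2

end OrliczFunction

/-! ### Trapezoid bumps and their integer translates -/

/-- The trapezoid function with plateau `[-1, 1]` and support `[-2, 2]`. -/
noncomputable def trapezoid (s : ℝ) : ℝ := max 0 (min 1 (2 - |s|))

theorem trapezoid_nonneg (s : ℝ) : 0 ≤ trapezoid s := le_max_left _ _

theorem trapezoid_le_one (s : ℝ) : trapezoid s ≤ 1 := max_le zero_le_one (min_le_left _ _)

theorem trapezoid_eq_one {s : ℝ} (h : |s| ≤ 1) : trapezoid s = 1 := by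
  rw [trapezoid, min_eq_left (by linarith), max_eq_right zero_le_one]

theorem trapezoid_eq_zero {s : ℝ} (h : 2 ≤ |s|) : trapezoid s = 0 :=
  max_eq_left ((min_le_right _ _).trans (by linarith))

theorem abs_trapezoid_sub_le (s t : ℝ) : |trapezoid s - trapezoid t| ≤ |s - t| := by
  have h1 := abs_max_sub_max_le_abs (min 1 (2 - |s|)) (min 1 (2 - |t|)) 0
  have h2 := abs_min_sub_min_le_max 1 (2 - |s|) 1 (2 - |t|)
  have h3 := abs_abs_sub_abs_le s t
  have h4 : |(2 - |s|) - (2 - |t|)| = |(|s| - |t|)| := by rw [← abs_neg]; congr 1; ring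
  have h5 : max |(1 : ℝ) - 1| |(2 - |s|) - (2 - |t|)| ≤ |s - t| := by
    rw [h4, sub_self, abs_zero]
    exact max_le (abs_nonneg _) h3
  rw [trapezoid, trapezoid, max_comm 0, max_comm 0]
  linarith

theorem abs_trapezoid_sub_le_one (s t : ℝ) : |trapezoid s - trapezoid t| ≤ 1 := by
  have := trapezoid_nonneg s
  have := trapezoid_nonneg t
  have := trapezoid_le_one s
  have := trapezoid_le_one t
  exact abs_le.2 ⟨by linarith, by linarith⟩

theorem abs_trapezoid_sub_le_min (s t : ℝ) :
    |trapezoid s - trapezoid t| ≤ min 1 |s - t| :=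
  le_min (abs_trapezoid_sub_le_one s t) (abs_trapezoid_sub_le s t)

theorem card_Icc_ceil_floor_le (s : ℝ) : (Finset.Icc ⌈s - 2⌉ ⌊s + 2⌋).card ≤ 5 := by
  rw [Int.card_Icc, Int.toNat_le]
  have h1 := Int.le_ceil (s - 2)
  have h2 := Int.floor_le (s + 2)
  have h3 : ((⌊s + 2⌋ - ⌈s - 2⌉ : ℤ) : ℝ) ≤ 4 := by push_cast; linarith
  have h4 : ⌊s + 2⌋ - ⌈s - 2⌉ ≤ 4 := by exact_mod_cast h3
  push_cast
  linarith

theorem mem_Icc_of_trapezoid_ne_zero {s : ℝ} {m : ℤ} (h : trapezoid (s - m) ≠ 0) :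
    m ∈ Finset.Icc ⌈s - 2⌉ ⌊s + 2⌋ := by
  have h1 : |s - m| < 2 := by
    by_contra! hcon
    exact h (trapezoid_eq_zero hcon)
  rw [abs_lt] at h1
  rw [Finset.mem_Icc, Int.ceil_le, Int.le_floor]
  exact ⟨by linarith, by linarith⟩

/-- Each of the two points meets at most five translates, so at most ten terms survive, and every
bump is 1-Lipschitz with values in `[0, 1]`. -/
theorem tsum_trapezoid_le {F : ℝ → ℝ} (hF : MonotoneOn F (Ici 0)) (hF0 : F 0 = 0) (s t : ℝ) :
    ∑' m : ℤ, ENNReal.ofReal (F |trapezoid (s - m) - trapezoid (t - m)|) ≤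
      ENNReal.ofReal (10 * F (min 1 |s - t|)) := by
  classical
  set A := Finset.Icc ⌈s - 2⌉ ⌊s + 2⌋ ∪ Finset.Icc ⌈t - 2⌉ ⌊t + 2⌋ with hA
  have hcard : A.card ≤ 10 := (Finset.card_union_le _ _).trans
    (add_le_add (card_Icc_ceil_floor_le s) (card_Icc_ceil_floor_le t))
  rw [tsum_eq_sum (s := A)]
  · calc ∑ m ∈ A, ENNReal.ofReal (F |trapezoid (s - m) - trapezoid (t - m)|)
        ≤ A.card • ENNReal.ofReal (F (min 1 |s - t|)) := by
          refine Finset.sum_le_card_nsmul _ _ _ fun m _ => ENNReal.ofReal_le_ofReal ?_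
          refine hF (mem_Ici.2 (abs_nonneg _)) (mem_Ici.2 (by positivity)) ?_
          have := abs_trapezoid_sub_le_min (s - m) (t - m)
          rwa [sub_sub_sub_cancel_right] at this
      _ ≤ 10 • ENNReal.ofReal (F (min 1 |s - t|)) := by gcongr
      _ = ENNReal.ofReal (10 * F (min 1 |s - t|)) := by
          rw [ENNReal.ofReal_mul (by norm_num), nsmul_eq_mul]
          simp
  · intro m hm
    rw [hA, Finset.mem_union, not_or] at hm
    have h1 : trapezoid (s - m) = 0 := by
      by_contra h
      exact hm.1 (mem_Icc_of_trapezoid_ne_zero h)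
    have h2 : trapezoid (t - m) = 0 := by
      by_contra h
      exact hm.2 (mem_Icc_of_trapezoid_ne_zero h)
    rw [h1, h2, sub_zero, abs_zero, hF0, ENNReal.ofReal_zero]

theorem nonpos_of_forall_le_rpow {a c : ℝ} (hc : 0 < c)
    (h : ∀ t : ℝ, 0 < t → t ≤ 1 → c ≤ t ^ a) : a ≤ 0 := by
  by_contra! ha
  have hc1 : c ≤ 1 := by simpa using h 1 one_pos le_rfl
  have h1 := h ((c / 2) ^ a⁻¹) (by positivity)
    (Real.rpow_le_one (by positivity) (by linarith) (by positivity))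
  rw [← Real.rpow_mul (by positivity), inv_mul_cancel₀ ha.ne', Real.rpow_one] at h1
  linarith

/-! ### The dyadic map for a strictly larger upper index -/

namespace OrliczFunction

variable {M N : OrliczFunction}

/-- At scales coarser than `d`, the exponent `q` already bounds the term by `c⁻¹ * M d`, and the
surplus `p - q > 0` leaves a geometric factor. At finer scales convexity makes `M (2^(-j))` itself
decay geometrically. -/
theorem exists_tsum_dyadic_le {p q c : ℝ} (hp : 0 < p) (hpq : q < p) (hc : 0 < c)
    (h : ∀ l t : ℝ, 0 < l → l ≤ 1 → 0 < t → t ≤ 1 → c * (M l * t ^ q) ≤ M (l * t)) :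
    ∃ C : ℝ, 0 ≤ C ∧ ∀ d : ℝ, 0 ≤ d →
      ∑' j : ℕ, ENNReal.ofReal (M ((1 / 2) ^ j) * min 1 (2 ^ j * d) ^ p) ≤
        ENNReal.ofReal (C * M (min d 1)) := by
  set b : ℝ := (1 / 2 : ℝ) ^ (p - q) with hb
  have hb0 : 0 < b := by positivity
  have hb1 : b < 1 := Real.rpow_lt_one (by norm_num) (by norm_num) (by linarith)
  refine ⟨c⁻¹ * (1 - b)⁻¹ + 2, by have := sub_pos.2 hb1; positivity, fun d hd => ?_⟩
  rcases hd.eq_or_lt with rfl | hd0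
  · simp [Real.zero_rpow hp.ne', M.map_zero]
  set e := min d 1 with he
  have he0 : 0 < e := by positivity
  have he1 : e ≤ 1 := min_le_right _ _
  have hMe := M.nonneg he0.le
  have hmin : ∀ j : ℕ, min 1 (2 ^ j * d) ≤ min 1 (2 ^ j * e) := fun j => by
    refine le_min (min_le_left _ _) ?_
    rcases le_total d 1 with h1 | h1
    · rw [he, min_eq_left h1]
      exact min_le_right _ _
    · rw [he, min_eq_right h1, mul_one]
      exact (min_le_left _ _).trans (one_le_pow₀ one_le_two)
  have hM : ∀ j : ℕ, 0 ≤ M ((1 / 2) ^ j) := fun j => M.nonneg (by positivity)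
  -- `J` separates the regimes: `2^(-j) ≥ e` exactly for `j ≤ J`.
  obtain ⟨J, hJ1, hJ2⟩ := exists_nat_pow_near_of_lt_one he0 he1
    (show (0 : ℝ) < 1 / 2 by norm_num) (by norm_num)
  rw [← ENNReal.summable.sum_add_tsum_nat_add' (k := J + 1), add_mul,
    ENNReal.ofReal_add (by have := sub_pos.2 hb1; positivity) (by positivity)]
  refine add_le_add ?_ ?_
  · rw [← ENNReal.ofReal_sum_of_nonneg fun j _ => mul_nonneg (hM j) (by positivity)]
    refine ENNReal.ofReal_le_ofReal ?_
    calc ∑ j ∈ Finset.range (J + 1), M ((1 / 2) ^ j) * min 1 (2 ^ j * d) ^ p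
        ≤ ∑ j ∈ Finset.range (J + 1), c⁻¹ * M e * b ^ (J + 1 - 1 - j) := by
          refine Finset.sum_le_sum fun j hj => ?_
          have hjJ : j ≤ J := Nat.lt_succ_iff.1 (Finset.mem_range.1 hj)
          set t := 2 ^ j * e with ht
          have ht0 : 0 < t := by positivity
          have htJ : t ≤ (1 / 2) ^ (J - j) := by
            calc t ≤ 2 ^ j * (1 / 2) ^ J := by rw [ht]; gcongr
              _ = (2 * (1 / 2)) ^ j * (1 / 2) ^ (J - j) := by
                rw [mul_pow, mul_assoc, ← pow_add, Nat.add_sub_cancel' hjJ]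
              _ = (1 / 2) ^ (J - j) := by norm_num
          have ht1 : t ≤ 1 := htJ.trans (pow_le_one₀ (by norm_num) (by norm_num))
          have h1 := h ((1 / 2) ^ j) t (by positivity) (pow_le_one₀ (by norm_num) (by norm_num))
            ht0 ht1
          have h2 : (1 / 2 : ℝ) ^ j * t = e := by
            rw [ht, ← mul_assoc, ← mul_pow]
            norm_num
          rw [h2] at h1
          have h3 : t ^ (p - q) ≤ b ^ (J - j) := by
            calc t ^ (p - q) ≤ ((1 / 2 : ℝ) ^ (J - j)) ^ (p - q) :=
                  Real.rpow_le_rpow ht0.le htJ (by linarith)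
              _ = b ^ (J - j) := by
                rw [hb, ← Real.rpow_natCast, ← Real.rpow_natCast, ← Real.rpow_mul (by norm_num),
                  ← Real.rpow_mul (by norm_num), mul_comm]
          have h4 : t ^ p = t ^ q * t ^ (p - q) := by
            rw [← Real.rpow_add ht0]
            congr 1
            ring
          calc M ((1 / 2) ^ j) * min 1 (2 ^ j * d) ^ p ≤ M ((1 / 2) ^ j) * t ^ p := by
                have := hM j
                gcongr
                exact (hmin j).trans (min_le_right _ _)
            _ = c⁻¹ * (c * (M ((1 / 2) ^ j) * t ^ q)) * t ^ (p - q) := by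
                rw [h4]; field_simp
            _ ≤ c⁻¹ * M e * b ^ (J + 1 - 1 - j) := by
                rw [Nat.add_sub_cancel]
                gcongr
      _ = c⁻¹ * M e * ∑ j ∈ Finset.range (J + 1), b ^ j := by
          rw [← Finset.mul_sum, Finset.sum_range_reflect (fun j => b ^ j)]
      _ ≤ c⁻¹ * M e * (1 - b)⁻¹ := by
          gcongr
          rw [← tsum_geometric_of_lt_one hb0.le hb1]
          exact (summable_geometric_of_lt_one hb0.le hb1).sum_le_tsum _ fun _ _ => by positivity
      _ = c⁻¹ * (1 - b)⁻¹ * M e := by ring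
  · calc ∑' j : ℕ, ENNReal.ofReal (M ((1 / 2) ^ (j + (J + 1))) * min 1 (2 ^ (j + (J + 1)) * d) ^ p)
        ≤ ∑' j : ℕ, ENNReal.ofReal (M e) * ENNReal.ofReal ((1 / 2) ^ j) := by
          refine ENNReal.tsum_le_tsum fun j => ?_
          rw [← ENNReal.ofReal_mul hMe]
          refine ENNReal.ofReal_le_ofReal ?_
          have h1 : min 1 (2 ^ (j + (J + 1)) * d) ^ p ≤ 1 :=
            Real.rpow_le_one (by positivity) (min_le_left _ _) hp.le
          have h2 : M ((1 / 2) ^ (j + (J + 1))) ≤ M (e * (1 / 2) ^ j) := by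
            refine M.mono (by positivity) ?_
            rw [pow_add, mul_comm]
            gcongr
          have h3 := M.map_mul_le (t := e) (u := (1 / 2) ^ j) he0.le (by positivity)
            (pow_le_one₀ (by norm_num) (by norm_num))
          have h4 := hM (j + (J + 1))
          nlinarith
      _ = ENNReal.ofReal (2 * M e) := by
          rw [ENNReal.tsum_mul_left, tsum_half_pow, ENNReal.ofReal_mul two_pos.le, mul_comm]
          simp

/-- Repeating a coordinate `k` times at height `l` imitates `w * u ^ p` inside `h_N`, up to a factor
`2` and a linear error as small as desired. -/
theorem exists_block {w : ℝ} (hw : 0 < w) {p ε : ℝ} (hp : 1 ≤ p) (h : (p : EReal) < N.upperIndex)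
    (hε : 0 < ε) : ∃ (l : ℝ) (k : ℕ), 0 < l ∧ l ≤ 1 ∧ w ≤ k * N l ∧
      ∀ u : ℝ, 0 ≤ u → u ≤ 1 → k * N (l * u) ≤ 2 * w * (u ^ p + ε * u) := by
  -- Keeping `N l ≤ w` ensures that rounding `w / N l` up costs at most a factor `2`.
  obtain ⟨δ, hδ, -, hδw⟩ := N.exists_pos_le hw
  obtain ⟨l, hl, hlδ, hl1, hlu⟩ := exists_scale hp h hε hδ
  have hNl := N.pos hl
  have hNw : N l ≤ w := (N.mono hl.le hlδ).trans hδw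
  refine ⟨l, ⌈w / N l⌉₊, hl, hl1, ?_, fun u hu hu1 => ?_⟩
  · rw [← div_le_iff₀ hNl]
    exact Nat.le_ceil _
  · have h1 : (⌈w / N l⌉₊ : ℝ) * N l ≤ 2 * w := by
      have h2 := (Nat.ceil_lt_add_one (show 0 ≤ w / N l by positivity)).le
      calc (⌈w / N l⌉₊ : ℝ) * N l ≤ (w / N l + 1) * N l := by gcongr
        _ = w + N l := by field_simp
        _ ≤ 2 * w := by linarith
    calc (⌈w / N l⌉₊ : ℝ) * N (l * u) ≤ ⌈w / N l⌉₊ * (N l * (u ^ p + ε * u)) := by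
          gcongr
          exact hlu u hu hu1
      _ = ⌈w / N l⌉₊ * N l * (u ^ p + ε * u) := by ring
      _ ≤ 2 * w * (u ^ p + ε * u) := by gcongr

theorem modular_sigma_fin {ι : Type*} {k : ι → ℕ} (l v : ι → ℝ) (hl : ∀ i, 0 < l i) :
    N.modular (fun a : Σ i, Fin (k i) => l a.1 * v a.1) =
      ∑' i, ENNReal.ofReal (k i * N (l i * |v i|)) := by
  rw [modular_sigma]
  refine tsum_congr fun i => ?_
  simp only [modular]
  rw [tsum_fintype, Finset.sum_const, Finset.card_univ, Fintype.card_fin, nsmul_eq_mul,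
    ENNReal.ofReal_mul (by positivity), ENNReal.ofReal_natCast, abs_mul, abs_of_pos (hl i)]

theorem tsum_trapezoid_rpow_le {p C : ℝ} (hp : 0 < p) (hC : 0 ≤ C)
    (h : ∀ d : ℝ, 0 ≤ d → ∑' j : ℕ, ENNReal.ofReal (M ((1 / 2) ^ j) * min 1 (2 ^ j * d) ^ p) ≤
      ENNReal.ofReal (C * M (min d 1))) (s t : ℝ) :
    ∑' (j : ℕ) (m : ℤ), ENNReal.ofReal (2 * M ((1 / 2) ^ j) *
        |trapezoid (2 ^ j * s - m) - trapezoid (2 ^ j * t - m)| ^ p) ≤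
      ENNReal.ofReal (20 * C) * ENNReal.ofReal (M (min |s - t| 1)) := by
  calc ∑' (j : ℕ) (m : ℤ), ENNReal.ofReal (2 * M ((1 / 2) ^ j) *
        |trapezoid (2 ^ j * s - m) - trapezoid (2 ^ j * t - m)| ^ p)
      ≤ ∑' j : ℕ, ENNReal.ofReal (20 : ℝ) * ENNReal.ofReal (M ((1 / 2) ^ j) *
          min 1 (2 ^ j * |s - t|) ^ p) := by
        refine ENNReal.tsum_le_tsum fun j => ?_
        have hwj : 0 < M ((1 / 2) ^ j) := M.pos (by positivity)
        refine (tsum_trapezoid_le (F := fun u => 2 * M ((1 / 2) ^ j) * u ^ p)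
          (fun a ha b _ hab => ?_) (by simp [Real.zero_rpow hp.ne']) _ _).trans_eq ?_
        · have ha0 : 0 ≤ a := ha
          dsimp only
          gcongr
        · rw [← ENNReal.ofReal_mul (by norm_num), ← mul_sub, abs_mul,
            abs_of_pos (show (0 : ℝ) < 2 ^ j by positivity)]
          congr 1
          ring
    _ ≤ ENNReal.ofReal 20 * ENNReal.ofReal (C * M (min |s - t| 1)) := by
        rw [ENNReal.tsum_mul_left]
        gcongr
        exact h _ (abs_nonneg _)
    _ = ENNReal.ofReal (20 * C) * ENNReal.ofReal (M (min |s - t| 1)) := by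
        rw [← ENNReal.ofReal_mul (by norm_num), ← ENNReal.ofReal_mul (by positivity), mul_assoc]

/-- Convexity gives `M t ≤ t * M 1`, so `t ^ q` cannot dominate `t` near zero. -/
theorem one_le_exponent {q c : ℝ} (hc : 0 < c)
    (h : ∀ l t : ℝ, 0 < l → l ≤ 1 → 0 < t → t ≤ 1 → c * (M l * t ^ q) ≤ M (l * t)) : 1 ≤ q := by
  have hM1 := M.pos one_pos
  refine sub_nonpos.1 (nonpos_of_forall_le_rpow hc fun t ht ht1 => ?_)
  have h1 := (h 1 t one_pos le_rfl ht ht1).trans (M.map_mul_le zero_le_one ht.le ht1)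
  have h2 : 0 < t ^ q := Real.rpow_pos_of_pos ht _
  rw [Real.rpow_sub ht, Real.rpow_one, le_div_iff₀ h2]
  nlinarith

theorem exists_dyadic_map (h : M.upperIndex < N.upperIndex) :
    ∃ (ι : Type) (_ : Countable ι) (Φ : (ℕ → ℝ) → ι → ℝ) (C : ℝ), 0 ≤ C ∧
      (∀ x y a, |Φ x a - Φ y a| ≤ 1) ∧
      (∀ (x y : ℕ → ℝ) (D : ℝ), (∀ n, |x n - y n| ≤ D) → N.modular (Φ x - Φ y) ≤
        ENNReal.ofReal C * M.modular (fun n => min |x n - y n| 1) + ENNReal.ofReal D) ∧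
      ∀ x y : ℕ → ℝ,
        M.modular (fun n => min (|x n - y n| / 6) (1 / 2)) ≤ N.modular (Φ x - Φ y) := by
  obtain ⟨q, hq, c, hc, hM⟩ := exists_of_upperIndex_lt h
  obtain ⟨p, hp1, hp, hqp⟩ : ∃ p : ℝ, 1 ≤ p ∧ (p : EReal) < N.upperIndex ∧ q < p := by
    obtain ⟨p, hqp, hp⟩ := EReal.lt_iff_exists_real_btwn.1 hq
    have hqp := EReal.coe_lt_coe_iff.1 hqp
    exact ⟨p, (one_le_exponent hc hM).trans hqp.le, hp, hqp⟩
  have hp0 : 0 < p := by linarith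
  obtain ⟨C, hC, hdy⟩ := exists_tsum_dyadic_le hp0 hqp hc hM
  obtain ⟨ε, hε, hεs⟩ := ENNReal.exists_pos_sum_of_countable one_ne_zero (ℕ × ℕ × ℤ)
  let w : ℕ × ℕ × ℤ → ℝ := fun i => M ((1 / 2) ^ i.2.1)
  have hw : ∀ i, 0 < w i := fun i => M.pos (by positivity)
  -- The block tolerance cancels the weight `2 * w i` and the Lipschitz constant `2 ^ j` of the
  -- bump, so the linear errors sum to at most `D * ∑ ε i ≤ D`.
  have hE : ∀ i : ℕ × ℕ × ℤ, 0 < (ε i : ℝ) / (2 * w i * 2 ^ i.2.1) := fun i => by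
    have := hw i
    have : 0 < (ε i : ℝ) := hε i
    positivity
  choose l k hl hl1 hwk hk using fun i => exists_block (hw i) hp1 hp (hE i)
  let v : (ℕ → ℝ) → ℕ × ℕ × ℤ → ℝ := fun x i => trapezoid (2 ^ i.2.1 * x i.1 - i.2.2)
  have hmod : ∀ x y, N.modular ((fun a : Σ i, Fin (k i) => l a.1 * v x a.1) -
      fun a : Σ i, Fin (k i) => l a.1 * v y a.1) =
      ∑' i, ENNReal.ofReal (k i * N (l i * |v x i - v y i|)) := fun x y => by
    rw [← modular_sigma_fin l (fun i => v x i - v y i) hl]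
    congr 1
    funext a
    simp only [Pi.sub_apply]
    ring
  refine ⟨Σ i : ℕ × ℕ × ℤ, Fin (k i), inferInstance, fun x a => l a.1 * v x a.1, 20 * C,
    by positivity, fun x y a => ?_, fun x y D hD => ?_, fun x y => ?_⟩
  · rw [← mul_sub, abs_mul, abs_of_pos (hl _)]
    exact mul_le_one₀ (hl1 _) (abs_nonneg _) (abs_trapezoid_sub_le_one _ _)
  · rw [hmod]
    have hD0 : 0 ≤ D := (abs_nonneg _).trans (hD 0)
    calc ∑' i, ENNReal.ofReal (k i * N (l i * |v x i - v y i|))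
        ≤ ∑' i, (ENNReal.ofReal (2 * w i * |v x i - v y i| ^ p) + ε i * ENNReal.ofReal D) := by
          refine ENNReal.tsum_le_tsum fun i => ?_
          have hwi := hw i
          rw [← ENNReal.ofReal_coe_nnreal (p := ε i), ← ENNReal.ofReal_mul (ε i).coe_nonneg,
            ← ENNReal.ofReal_add (by positivity) (mul_nonneg (ε i).coe_nonneg hD0)]
          refine ENNReal.ofReal_le_ofReal ((hk i _ (abs_nonneg _)
            (abs_trapezoid_sub_le_one _ _)).trans ?_)
          rw [mul_add]
          refine add_le_add le_rfl ?_
          have h1 : |v x i - v y i| ≤ 2 ^ i.2.1 * D := by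
            refine (abs_trapezoid_sub_le _ _).trans ?_
            rw [sub_sub_sub_cancel_right, ← mul_sub, abs_mul, abs_of_pos (by positivity)]
            gcongr
            exact hD _
          calc 2 * w i * (ε i / (2 * w i * 2 ^ i.2.1) * |v x i - v y i|)
              ≤ 2 * w i * (ε i / (2 * w i * 2 ^ i.2.1) * (2 ^ i.2.1 * D)) := by gcongr
            _ = ε i * D := by field_simp
      _ = ∑' i, ENNReal.ofReal (2 * w i * |v x i - v y i| ^ p) +
            (∑' i, (ε i : ℝ≥0∞)) * ENNReal.ofReal D := by
          rw [ENNReal.tsum_add, ENNReal.tsum_mul_right]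
      _ ≤ ENNReal.ofReal (20 * C) * M.modular (fun n => min |x n - y n| 1) + ENNReal.ofReal D := by
          refine add_le_add ?_ (mul_le_of_le_one_left' hεs.le)
          rw [ENNReal.tsum_prod', modular, ← ENNReal.tsum_mul_left]
          refine ENNReal.tsum_le_tsum fun n => ?_
          rw [ENNReal.tsum_prod', abs_of_nonneg (show 0 ≤ min |x n - y n| 1 by positivity)]
          exact tsum_trapezoid_rpow_le hp0 hC hdy (x n) (y n)
  · rw [hmod, ENNReal.tsum_prod', modular]
    refine ENNReal.tsum_le_tsum fun n => ?_
    rcases (abs_nonneg (x n - y n)).eq_or_lt with h0 | h0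
    · rw [← h0]
      simp [M.map_zero]
    set d := |x n - y n| with hd
    set e := min (d / 3) 1 with he
    -- At scale `2^(-(j+1))` the points are at least `3` units apart. The bump at the integer part
    -- of the first equals `1` there and vanishes at the second, and its weight is at least `M (e /
    -- 2)`.
    obtain ⟨j, hj1, hj2⟩ := exists_nat_pow_near_of_lt_one (show 0 < e by positivity)
      (min_le_right _ _) (show (0 : ℝ) < 1 / 2 by norm_num) (by norm_num)
    set m : ℤ := ⌊2 ^ (j + 1) * x n⌋ with hm
    refine le_trans ?_ (ENNReal.le_tsum (j + 1, m))
    refine ENNReal.ofReal_le_ofReal ?_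
    have h1 : |2 ^ (j + 1) * x n - m| ≤ 1 := by
      rw [abs_of_nonneg (sub_nonneg.2 (Int.floor_le _))]
      linarith [Int.lt_floor_add_one (2 ^ (j + 1) * x n)]
    have h2 : 3 ≤ |2 ^ (j + 1) * x n - 2 ^ (j + 1) * y n| := by
      rw [← mul_sub, abs_mul, abs_of_pos (by positivity)]
      have h3 : (1 / 2) ^ (j + 1) ≤ d / 3 := hj1.le.trans (min_le_left _ _)
      calc (3 : ℝ) = 2 ^ (j + 1) * (3 * (1 / 2) ^ (j + 1)) := by
            rw [mul_left_comm, ← mul_pow]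
            norm_num
        _ ≤ 2 ^ (j + 1) * d := by gcongr; linarith
    have h3 : 2 ≤ |2 ^ (j + 1) * y n - m| := by
      have := abs_sub_abs_le_abs_sub (2 ^ (j + 1) * x n - 2 ^ (j + 1) * y n)
        (2 ^ (j + 1) * x n - m)
      rw [sub_sub_sub_cancel_left, abs_sub_comm (m : ℝ)] at this
      linarith
    have h4 : |v x (n, j + 1, m) - v y (n, j + 1, m)| = 1 := by
      simp only [v]
      rw [trapezoid_eq_one h1, trapezoid_eq_zero h3]
      norm_num
    rw [h4, mul_one]
    refine le_trans ?_ (hwk _)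
    refine M.mono (abs_nonneg _) ?_
    rw [abs_of_nonneg (by positivity)]
    have h5 : min (d / 6) (1 / 2) = e * (1 / 2) := by
      rw [he, min_mul_of_nonneg _ _ (by norm_num)]
      congr 1 <;> ring
    rw [h5, pow_succ]
    gcongr

/-- The case of a strictly larger upper index. -/
theorem exists_hasStrongControl_of_upperIndex_lt (h : M.upperIndex < N.upperIndex)
    (hN : N.upperIndex < ⊤) : ∃ f : M.hSpace → N.hSpace, HasStrongControl f := by
  have hMd := isDoubling_of_upperIndex_lt_top (h.trans hN)
  obtain ⟨ι, _, Φ, C, hC, hT, hup, hlow⟩ := exists_dyadic_map h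
  obtain ⟨T, hT1, hT0⟩ : ∃ T : ℝ, 1 < M T ∧ 0 < T :=
    ((M.tendsto_atTop.eventually_gt_atTop 1).and (eventually_gt_atTop 0)).exists
  have hcoord : ∀ (z : M.hSpace) (r : ℝ), ‖z‖ < r → ∀ n, |z.1 n| ≤ r * T := fun z r hz n => by
    have hr : 0 < r := (norm_nonneg z).trans_lt hz
    have h1 := abs_le_of_modular_le hT0.le ((modular_div_le_one_of_norm_lt hz).trans
      (ENNReal.one_le_ofReal.2 hT1.le)) n
    rwa [abs_div, abs_of_pos hr, div_le_iff₀' hr] at h1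
  have hsub : ∀ (x y : M.hSpace) n, (x - y).1 n = x.1 n - y.1 n := fun x y n => rfl
  refine exists_hasStrongControl_of_bounded_scale
    (isDoubling_of_upperIndex_lt_top hN) (fun x : M.hSpace => Φ x.1) 1 (fun x y a => hT _ _ a)
    (fun S => ?_) (fun ε hε => ?_) (fun ε hε => ?_)
  · set R := max S 0 + 1 with hR
    have hR0 : 0 < R := by positivity
    have hSR : S < R := by have := le_max_left S 0; rw [hR]; linarith
    obtain ⟨K, hK, hKle⟩ := hMd.exists_modular_le 1 (inv_pos.2 hR0)
    refine ⟨C * K + R * T, by positivity, fun x y hxy => ?_⟩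
    have hxR := hxy.trans_lt hSR
    refine (hup _ _ (R * T) fun n => hcoord (x - y) R hxR n).trans ?_
    rw [ENNReal.ofReal_add (by positivity) (by positivity), ENNReal.ofReal_mul hC]
    gcongr
    have h1 := hKle (fun n => min |(x - y).1 n| 1 / R) fun n => by
      rw [abs_div, abs_of_pos hR0, abs_of_nonneg (by positivity), div_le_one hR0]
      have := le_max_right S 0
      exact (min_le_right _ _).trans (by rw [hR]; linarith)
    simp only [div_div, mul_inv_cancel₀ hR0.ne', div_one] at h1
    refine h1.trans (mul_le_of_le_one_right' ?_)
    refine (modular_mono fun n => ?_).trans (modular_div_le_one_of_norm_lt hxR)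
    rw [abs_div, abs_div, abs_of_pos hR0, abs_of_nonneg (show 0 ≤ min |(x - y).1 n| 1 by positivity)]
    gcongr
    exact min_le_left _ _
  · set r := min 1 (ε / (C + T)) with hr
    have hr0 : 0 < r := by positivity
    refine ⟨r, hr0, fun x y hxy => ?_⟩
    refine (hup _ _ (r * T) fun n => hcoord (x - y) r hxy n).trans ?_
    have h1 : M.modular (fun n => min |x.1 n - y.1 n| 1) ≤ ENNReal.ofReal r := by
      refine (modular_mono fun n => ?_).trans (modular_le_of_norm_lt (min_le_left _ _) hxy)
      rw [hsub, abs_of_nonneg (show 0 ≤ min |x.1 n - y.1 n| 1 by positivity)]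
      exact min_le_left _ _
    calc ENNReal.ofReal C * M.modular (fun n => min |x.1 n - y.1 n| 1) + ENNReal.ofReal (r * T)
        ≤ ENNReal.ofReal C * ENNReal.ofReal r + ENNReal.ofReal (r * T) := by gcongr
      _ = ENNReal.ofReal (r * (C + T)) := by
          rw [← ENNReal.ofReal_mul hC, ← ENNReal.ofReal_add (by positivity) (by positivity)]
          congr 1
          ring
      _ ≤ ENNReal.ofReal ε := by
          refine ENNReal.ofReal_le_ofReal ?_
          rw [← le_div_iff₀ (by positivity)]
          exact min_le_right _ _
  · obtain ⟨η, hη, hle⟩ := hMd.exists_norm_le (1 / 2) (show 0 < ε / 12 by positivity)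
    have hM2 := M.pos (show (0 : ℝ) < 1 / 2 by norm_num)
    -- Staying below `M (1 / 2)` rules out that the truncation at `1 / 2` is active in any
    -- coordinate.
    refine ⟨min η (M (1 / 2) / 2), by positivity, fun x y hxy => ?_⟩
    have h1 := (hlow _ _).trans hxy
    have h2 : ∀ n, |x.1 n - y.1 n| / 6 ≤ 1 / 2 := fun n => by
      by_contra! hcon
      have h3 := le_of_modular_le (by positivity) h1 n
      rw [min_eq_right hcon.le, abs_of_pos (by norm_num)] at h3
      have := min_le_right η (M (1 / 2) / 2)
      linarith
    have h3 : ∀ n, |((1 / 6 : ℝ) • (x - y)).1 n| = |x.1 n - y.1 n| / 6 := fun n => by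
      change |(1 / 6 : ℝ) * (x.1 n - y.1 n)| = _
      rw [abs_mul, abs_of_pos (by norm_num)]
      ring
    have h4 := hle ((1 / 6 : ℝ) • (x - y)) (fun n => (h3 n).trans_le (h2 n)) (by
      refine le_trans (modular_mono fun n => ?_)
        (h1.trans (ENNReal.ofReal_le_ofReal (min_le_left _ _)))
      rw [h3, min_eq_left (h2 n), abs_div, abs_abs, abs_of_pos (show (0 : ℝ) < 6 by norm_num)])
    rw [norm_smul, Real.norm_of_nonneg (by norm_num)] at h4
    linarith

end OrliczFunction

/-! ### Normalized exponential vectors -/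

theorem hasSum_prod_fin {a : ℕ → ℝ} (ha : Summable fun n => |a n|) (k : ℕ) :
    HasSum (fun I : Fin k → ℕ => ∏ l, a (I l)) ((∑' n, a n) ^ k) ∧
      Summable fun I : Fin k → ℕ => |∏ l, a (I l)| := by
  induction k with
  | zero => exact ⟨by simp, (hasSum_unique _).summable⟩
  | succ k ih =>
    let e : ℕ × (Fin k → ℕ) ≃ (Fin (k + 1) → ℕ) := Fin.consEquiv fun _ => ℕ
    have he : ∀ J, ∏ l, a (e J l) = a J.1 * ∏ l, a (J.2 l) := fun J => by
      rw [Fin.prod_univ_succ]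
      simp [e, Fin.consEquiv_apply]
    constructor
    · rw [← e.hasSum_iff, pow_succ']
      simp only [Function.comp_def, he]
      have hp : Summable fun J : ℕ × (Fin k → ℕ) => a J.1 * ∏ l, a (J.2 l) :=
        summable_mul_of_summable_norm (f := a) (g := fun I : Fin k → ℕ => ∏ l, a (I l)) ha ih.2
      exact HasSum.mul (f := a) (g := fun I : Fin k → ℕ => ∏ l, a (I l))
        ha.of_abs.hasSum ih.1 hp
    · rw [← e.summable_iff]
      simp only [Function.comp_def, he, abs_mul]
      exact ha.mul_of_nonneg ih.2 (fun _ => abs_nonneg _) fun _ => abs_nonneg _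

/-- This is the exponential series with each power of `∑ a n` expanded over `k`-tuples; absolute
convergence permits the rearrangement. -/
theorem hasSum_exp_sigma {a : ℕ → ℝ} (ha : Summable fun n => |a n|) :
    HasSum (fun I : Σ k : ℕ, (Fin k → ℕ) => 2 ^ I.1 / (I.1.factorial : ℝ) * ∏ l, a (I.2 l))
      (Real.exp (2 * ∑' n, a n)) := by
  have key : ∀ {b : ℕ → ℝ}, (Summable fun n => |b n|) → ∀ k : ℕ,
      HasSum (fun I : Fin k → ℕ => 2 ^ k / (k.factorial : ℝ) * ∏ l, b (I l))
        ((2 * ∑' n, b n) ^ k / (k.factorial : ℝ)) := fun hb k => by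
    rw [mul_pow, mul_div_right_comm]
    exact (hasSum_prod_fin hb k).1.mul_left _
  refine HasSum.sigma_of_hasSum
    (by
      rw [Real.exp_eq_exp_ℝ]
      exact NormedSpace.expSeries_div_hasSum_exp _) (key ha) ?_
  refine Summable.of_abs ?_
  have hb : Summable fun n => |(|a n|)| := by simpa only [abs_abs] using ha
  have habs : ∀ I : Σ k : ℕ, (Fin k → ℕ), |2 ^ I.1 / (I.1.factorial : ℝ) * ∏ l, a (I.2 l)| =
      2 ^ I.1 / (I.1.factorial : ℝ) * ∏ l, |a (I.2 l)| := fun I => by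
    rw [abs_mul, Finset.abs_prod, abs_of_nonneg (by positivity)]
  simp only [habs]
  rw [summable_sigma_of_nonneg fun I => by positivity]
  refine ⟨fun k => (key hb k).summable, ?_⟩
  simp only [(key hb _).tsum_eq]
  exact (NormedSpace.expSeries_div_hasSum_exp (2 * ∑' n, |a n|)).summable

/-- The coefficients of the normalized exponential vector of a square summable sequence in the
Fock space over `ℓ₂`. -/
noncomputable def fockVector (x : ℕ → ℝ) (I : Σ k : ℕ, (Fin k → ℕ)) : ℝ :=
  Real.exp (-∑' n, x n ^ 2) * √(2 ^ I.1 / (I.1.factorial : ℝ)) * ∏ l, x (I.2 l)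

/-- The unnormalized inner product is `exp (2⟨x, y⟩)`; the factors `exp (-‖x‖²)` and `exp (-‖y‖²)`
complete the square. -/
theorem hasSum_fockVector_mul {x y : ℕ → ℝ} (hx : Summable fun n => x n ^ 2)
    (hy : Summable fun n => y n ^ 2) :
    HasSum (fun I => fockVector x I * fockVector y I) (Real.exp (-∑' n, (x n - y n) ^ 2)) := by
  have hxy : Summable fun n => |x n * y n| :=
    Summable.of_nonneg_of_le (fun _ => abs_nonneg _)
      (fun n => by
        rw [abs_mul]
        nlinarith [sq_abs (x n), sq_abs (y n), sq_nonneg (|x n| - |y n|),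
          sq_nonneg (x n), sq_nonneg (y n)]) (hx.add hy)
  have h1 := (hasSum_exp_sigma hxy).mul_left
    (Real.exp (-∑' n, x n ^ 2) * Real.exp (-∑' n, y n ^ 2))
  have h2 : ∑' n, (x n - y n) ^ 2 =
      ∑' n, x n ^ 2 + ∑' n, y n ^ 2 - 2 * ∑' n, x n * y n := by
    rw [← tsum_mul_left, ← hx.tsum_add hy, ← (hx.add hy).tsum_sub (hxy.of_abs.mul_left 2)]
    exact tsum_congr fun n => by ring
  have h3 : Real.exp (-∑' n, (x n - y n) ^ 2) = Real.exp (-∑' n, x n ^ 2) *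
      Real.exp (-∑' n, y n ^ 2) * Real.exp (2 * ∑' n, x n * y n) := by
    rw [h2, ← Real.exp_add, ← Real.exp_add]
    congr 1
    ring
  rw [h3]
  rw [show (fun I => fockVector x I * fockVector y I) = _ from funext fun I => ?_]
  · exact h1
  have h4 : √(2 ^ I.1 / (I.1.factorial : ℝ)) * √(2 ^ I.1 / (I.1.factorial : ℝ)) =
    2 ^ I.1 / (I.1.factorial : ℝ) := Real.mul_self_sqrt (by positivity)
  rw [fockVector, fockVector, Finset.prod_mul_distrib]
  linear_combination (Real.exp (-∑' n, x n ^ 2) * Real.exp (-∑' n, y n ^ 2) *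
    (∏ l, x (I.2 l)) * ∏ l, y (I.2 l)) * h4

theorem hasSum_fockVector_sq {x : ℕ → ℝ} (hx : Summable fun n => x n ^ 2) :
    HasSum (fun I => fockVector x I ^ 2) 1 := by
  simpa [← sq] using hasSum_fockVector_mul hx hx

theorem hasSum_fockVector_sub_sq {x y : ℕ → ℝ} (hx : Summable fun n => x n ^ 2)
    (hy : Summable fun n => y n ^ 2) :
    HasSum (fun I => (fockVector x I - fockVector y I) ^ 2)
      (2 - 2 * Real.exp (-∑' n, (x n - y n) ^ 2)) := by
  have h := ((hasSum_fockVector_sq hx).add (hasSum_fockVector_sq hy)).sub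
    ((hasSum_fockVector_mul hx hy).mul_left 2)
  rw [one_add_one_eq_two] at h
  have e : (fun I => (fockVector x I - fockVector y I) ^ 2) = fun I => fockVector x I ^ 2 +
      fockVector y I ^ 2 - 2 * (fockVector x I * fockVector y I) := funext fun I => by ring
  rwa [e]

/-! ### Mazur maps and the embedding of Hilbert space -/

namespace OrliczFunction

variable {M N : OrliczFunction}

theorem map_sub_le {s t : ℝ} (ht : 0 ≤ t) (hts : t ≤ s) : N (s - t) ≤ N s - N t := by
  rcases ht.eq_or_lt with rfl | ht0
  · simp [N.map_zero]
  have hs : 0 < s := ht0.trans_le hts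
  have h1 := N.map_mul_le (t := s) (u := t / s) hs.le (by positivity) ((div_le_one hs).2 hts)
  have h2 := N.map_mul_le (t := s) (u := (s - t) / s) hs.le
    (div_nonneg (sub_nonneg.2 hts) hs.le) ((div_le_one hs).2 (by linarith))
  rw [mul_div_cancel₀ _ hs.ne'] at h1 h2
  have h3 : t / s * N s + (s - t) / s * N s = N s := by
    field_simp
    ring
  linarith

/-- Convexity is applied to `s + h = (1 - 2δ) * s + δ * (2 * s) + δ * (h / δ)`. Small `δ` makes the
error in `N s` negligible, at the price of enlarging `h`. -/
theorem map_add_le_of_doubling {K T δ s h : ℝ} (hK : ∀ t : ℝ, 0 ≤ t → t ≤ T → N (2 * t) ≤ K * N t)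
    (hδ : 0 < δ) (hδ1 : δ ≤ 1 / 2) (hs : 0 ≤ s) (hsT : s ≤ T) (hh : 0 ≤ h) :
    N (s + h) ≤ N s + δ * K * N s + δ * N (h / δ) := by
  have h1 := N.convexOn.map_sum_le (t := Finset.univ) (w := ![1 - 2 * δ, δ, δ])
    (p := ![s, 2 * s, h / δ]) (fun i _ => by fin_cases i <;> simp <;> linarith)
    (by simp [Fin.sum_univ_three]; ring)
    (fun i _ => by fin_cases i <;> simp <;> positivity)
  simp only [Fin.sum_univ_three, smul_eq_mul, Matrix.cons_val_zero, Matrix.cons_val_one,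
    Matrix.cons_val] at h1
  have h2 : (1 - 2 * δ) * s + δ * (2 * s) + δ * (h / δ) = s + h := by
    field_simp
    ring
  rw [h2] at h1
  have h3 := hK s hs hsT
  have h4 := N.nonneg hs
  have h5 : δ * N (2 * s) ≤ δ * (K * N s) := by gcongr
  nlinarith

theorem exists_map_eq {a : ℝ} (ha : 0 ≤ a) : ∃ y : ℝ, 0 ≤ y ∧ N y = a := by
  obtain ⟨T, hT, hT0⟩ := ((N.tendsto_atTop.eventually_ge_atTop a).and (eventually_ge_atTop 0)).exists
  obtain ⟨y, hy, rfl⟩ := intermediate_value_Icc hT0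
    (N.continuousOn.mono fun y hy => hy.1) ⟨by rwa [N.map_zero], hT⟩
  exact ⟨y, hy.1, rfl⟩

/-- There is a Mazur map: an odd change of variables carrying squares to values of `N`. -/
theorem exists_mazur (N : OrliczFunction) : ∃ Y : ℝ → ℝ, (∀ a, N |Y a| = a ^ 2) ∧
    (∀ a, 0 ≤ a → 0 ≤ Y a) ∧ ∀ a, a ≤ 0 → Y a ≤ 0 := by
  choose y hy0 hy using fun a : ℝ => N.exists_map_eq (sq_nonneg a)
  refine ⟨fun a => if 0 ≤ a then y a else -y a, fun a => ?_, fun a ha => ?_, fun a ha => ?_⟩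
  · dsimp only
    split_ifs <;> simp [abs_of_nonneg (hy0 a), hy a]
  · simp [ha, hy0 a]
  · rcases ha.eq_or_lt with rfl | ha
    · have : y 0 = 0 := by
        by_contra h
        exact N.nondegenerate _ (lt_of_le_of_ne (hy0 0) (Ne.symm h)) (by simpa using hy 0)
      simp [this]
    · simp [not_le.2 ha, hy0 a]

/-- Superadditivity of `N` for equal signs and convexity for opposite signs bound the left side by
`|a - b| * (|a| + |b|)`; a weighted AM-GM inequality then separates the factors so that they can be
summed. -/
theorem mazur_upper {Y : ℝ → ℝ} (hY : ∀ a, N |Y a| = a ^ 2) (hp : ∀ a, 0 ≤ a → 0 ≤ Y a)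
    (hn : ∀ a, a ≤ 0 → Y a ≤ 0) {η : ℝ} (hη : 0 < η) (a b : ℝ) :
    N (|Y a - Y b| / 2) ≤ (a - b) ^ 2 / (2 * η) + η * (a ^ 2 + b ^ 2) := by
  have h1 : N (|Y a - Y b| / 2) ≤ |a - b| * (|a| + |b|) := by
    have hhalf : ∀ u : ℝ, 0 ≤ u → N (u / 2) ≤ N u := fun u hu =>
      N.mono (by positivity) (by linarith)
    have opp : ∀ a b : ℝ, 0 ≤ a → b ≤ 0 → N (|Y a - Y b| / 2) ≤ |a - b| * (|a| + |b|) := by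
      intro a b ha hb
      have e1 := N.map_add_le (Y a) (-Y b) one_pos one_pos
      rw [← sub_eq_add_neg, abs_neg, div_one, div_one, hY, hY] at e1
      norm_num at e1
      rw [abs_of_nonneg (show 0 ≤ a - b by linarith), abs_of_nonneg ha, abs_of_nonpos hb]
      nlinarith [mul_nonneg ha (neg_nonneg.2 hb)]
    have same : ∀ a b : ℝ, |Y a - Y b| = |(|Y a| - |Y b|)| → N (|Y a - Y b| / 2) ≤
        |a ^ 2 - b ^ 2| := by
      intro a b h
      refine (hhalf _ (abs_nonneg _)).trans ?_
      rw [h, ← hY a, ← hY b]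
      rcases le_total |Y a| |Y b| with h | h
      · rw [abs_sub_comm, abs_of_nonneg (sub_nonneg.2 h), abs_sub_comm]
        exact (map_sub_le (abs_nonneg _) h).trans (le_abs_self _)
      · rw [abs_of_nonneg (sub_nonneg.2 h)]
        exact (map_sub_le (abs_nonneg _) h).trans (le_abs_self _)
    have hsq : |a ^ 2 - b ^ 2| ≤ |a - b| * (|a| + |b|) := by
      rw [sq_sub_sq, abs_mul, mul_comm]
      gcongr
      exact abs_add_le a b
    rcases le_total 0 a with ha | ha <;> rcases le_total 0 b with hb | hb
    · refine (same a b ?_).trans hsq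
      rw [abs_of_nonneg (hp a ha), abs_of_nonneg (hp b hb)]
    · exact opp a b ha hb
    · rw [abs_sub_comm, abs_sub_comm a, add_comm]
      exact opp b a hb ha
    · refine (same a b ?_).trans hsq
      rw [abs_of_nonpos (hn a ha), abs_of_nonpos (hn b hb), ← abs_neg]
      congr 1
      ring
  refine h1.trans ?_
  rw [div_add' _ _ _ (by positivity), le_div_iff₀ (by positivity), ← sq_abs (a - b),
    ← sq_abs a, ← sq_abs b]
  nlinarith [sq_nonneg (|a - b| - η * (|a| + |b|)), sq_nonneg (η * (|a| - |b|))]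

/-- For equal signs `(a - b)²` is at most `|a² - b²|`, an increment of `N`, which doubling controls.
For opposite signs `|Y a|` and `|Y b|` are both at most `|Y a - Y b|`. -/
theorem mazur_lower {Y : ℝ → ℝ} (hY : ∀ a, N |Y a| = a ^ 2) (hp : ∀ a, 0 ≤ a → 0 ≤ Y a)
    (hn : ∀ a, a ≤ 0 → Y a ≤ 0) {K T δ : ℝ} (hK0 : 0 ≤ K)
    (hK : ∀ t : ℝ, 0 ≤ t → t ≤ T → N (2 * t) ≤ K * N t)
    (hδ : 0 < δ) (hδ1 : δ ≤ 1 / 2) {a b : ℝ} (ha : |Y a| ≤ T) (hb : |Y b| ≤ T) :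
    (a - b) ^ 2 / 2 ≤ δ * K * (a ^ 2 + b ^ 2) + 2 * δ * N (|Y a - Y b| / δ) := by
  have hnn : ∀ u v : ℝ, 0 ≤ N (|u - v| / δ) := fun u v => N.nonneg_abs_div _ hδ
  have opp : ∀ a b : ℝ, 0 ≤ a → b ≤ 0 →
      (a - b) ^ 2 / 2 ≤ δ * K * (a ^ 2 + b ^ 2) + 2 * δ * N (|Y a - Y b| / δ) := by
    intro a b ha hb
    have e0 : ∀ u : ℝ, 0 ≤ u → u ≤ |Y a - Y b| → N u ≤ δ * N (|Y a - Y b| / δ) := by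
      intro u hu huv
      have h1 := N.map_mul_le (t := |Y a - Y b| / δ) (u := δ) (by positivity) hδ.le (by linarith)
      rw [div_mul_cancel₀ _ hδ.ne'] at h1
      exact (N.mono hu huv).trans h1
    have e1 := e0 |Y a| (abs_nonneg _) (by
      have := hp a ha
      have := hn b hb
      rw [abs_of_nonneg (hp a ha), abs_of_nonneg (by linarith)]
      linarith)
    have e2 := e0 |Y b| (abs_nonneg _) (by
      have := hp a ha
      have := hn b hb
      rw [abs_of_nonpos (hn b hb), abs_of_nonneg (by linarith)]
      linarith)
    rw [hY] at e1 e2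
    have : 0 ≤ δ * K * (a ^ 2 + b ^ 2) := by positivity
    nlinarith [sq_nonneg (a + b)]
  have same : ∀ a b : ℝ, |Y a - Y b| = |(|Y a| - |Y b|)| → |Y b| ≤ |Y a| → |Y b| ≤ T → 0 ≤ a * b →
      (a - b) ^ 2 / 2 ≤ δ * K * (a ^ 2 + b ^ 2) + 2 * δ * N (|Y a - Y b| / δ) := by
    intro a b h hba hbT hab
    have h1 := map_add_le_of_doubling hK hδ hδ1 (abs_nonneg (Y b)) hbT (sub_nonneg.2 hba)
    rw [add_sub_cancel, hY, hY] at h1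
    rw [h, abs_of_nonneg (sub_nonneg.2 hba)]
    have h2 : b ^ 2 ≤ a ^ 2 := by
      rw [← hY, ← hY]
      exact N.mono (abs_nonneg _) hba
    have h3 : (a - b) ^ 2 ≤ a ^ 2 - b ^ 2 := by
      have : |b| ≤ |a| := sq_le_sq.1 h2
      have : b ^ 2 ≤ a * b := by
        rw [← sq_abs, ← abs_of_nonneg hab, abs_mul, sq]
        gcongr
      nlinarith
    have h4 : 0 ≤ δ * N ((|Y a| - |Y b|) / δ) :=
      mul_nonneg hδ.le (N.nonneg (div_nonneg (sub_nonneg.2 hba) hδ.le))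
    have h5 : 0 ≤ δ * K * a ^ 2 := by positivity
    nlinarith [sq_nonneg (a - b)]
  have same' : |Y a - Y b| = |(|Y a| - |Y b|)| → 0 ≤ a * b →
      (a - b) ^ 2 / 2 ≤ δ * K * (a ^ 2 + b ^ 2) + 2 * δ * N (|Y a - Y b| / δ) := by
    intro h hab
    rcases le_total |Y a| |Y b| with h' | h'
    · have := same b a (by rw [abs_sub_comm, h, abs_sub_comm]) h' ha (by rwa [mul_comm])
      rwa [abs_sub_comm, add_comm (b ^ 2), sub_sq_comm] at this
    · exact same a b h h' hb hab
  rcases le_total 0 a with ha' | ha' <;> rcases le_total 0 b with hb' | hb'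
  · refine same' ?_ (mul_nonneg ha' hb')
    rw [abs_of_nonneg (hp a ha'), abs_of_nonneg (hp b hb')]
  · exact opp a b ha' hb'
  · have := opp b a hb' ha'
    rwa [abs_sub_comm, add_comm (b ^ 2), sub_sq_comm] at this
  · refine same' ?_ (mul_nonneg_of_nonpos_of_nonpos ha' hb')
    rw [abs_of_nonpos (hn a ha'), abs_of_nonpos (hn b hb'), ← abs_neg]
    congr 1
    ring

/-- The Orlicz function `t ^ 2`, whose sequence space is Hilbert space. -/
def square : OrliczFunction where
  toFun t := t ^ 2
  continuousOn := (continuous_pow 2).continuousOn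
  monotoneOn := fun _ hs _ _ hst => pow_le_pow_left₀ hs hst 2
  convexOn := convexOn_pow 2
  map_zero := by norm_num
  tendsto_atTop := tendsto_pow_atTop two_ne_zero
  nondegenerate t ht := by positivity

theorem square_apply (t : ℝ) : square t = t ^ 2 := rfl

theorem square_exponent {q : ℝ} : (∃ c : ℝ, 0 < c ∧
    ∀ l ∈ Ioc (0 : ℝ) 1, ∀ t ∈ Ioc (0 : ℝ) 1, c ≤ square (l * t) / (square l * t ^ q)) ↔
    2 ≤ q := by
  constructor
  · rintro ⟨c, hc, h⟩
    refine sub_nonpos.1 (nonpos_of_forall_le_rpow hc fun t ht ht1 => ?_)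
    have h1 := h 1 ⟨one_pos, le_rfl⟩ t ⟨ht, ht1⟩
    rw [Real.rpow_sub ht]
    simpa [square_apply] using h1
  · intro hq
    refine ⟨1, one_pos, fun l hl t ht => ?_⟩
    have hl0 := hl.1
    have ht0 := ht.1
    rw [square_apply, square_apply, le_div_iff₀ (by positivity), one_mul, mul_pow]
    gcongr
    rw [← Real.rpow_natCast]
    exact Real.rpow_le_rpow_of_exponent_ge ht0 ht.2 (by exact_mod_cast hq)

theorem upperIndex_square : square.upperIndex = 2 := by
  refine le_antisymm (sInf_le ⟨2, square_exponent.2 le_rfl, rfl⟩) (le_sInf ?_)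
  rintro _ ⟨q, hq, rfl⟩
  exact EReal.coe_le_coe_iff.2 (square_exponent.1 hq)

theorem summable_sq (z : square.hSpace) : Summable fun n => z.1 n ^ 2 := by
  have := z.2 1 one_pos
  simpa [square_apply] using this

theorem modular_square {z : ℕ → ℝ} (hz : Summable fun n => z n ^ 2) (r : ℝ) :
    square.modular (fun n => z n / r) = ENNReal.ofReal ((∑' n, z n ^ 2) / r ^ 2) := by
  simp only [modular, square_apply, sq_abs, div_pow]
  rw [← ENNReal.ofReal_tsum_of_nonneg (fun n => by positivity) (hz.div_const _), tsum_div_const]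

theorem tsum_sq_le_of_norm_lt {z : square.hSpace} {r : ℝ} (h : ‖z‖ < r) :
    ∑' n, z.1 n ^ 2 ≤ r ^ 2 := by
  have hr : 0 < r := (norm_nonneg z).trans_lt h
  have h1 := modular_div_le_one_of_norm_lt h
  rw [modular_square (summable_sq z), ENNReal.ofReal_le_one, div_le_one (by positivity)] at h1
  exact h1

theorem norm_le_of_tsum_sq_le {z : square.hSpace} {r : ℝ} (hr : 0 < r)
    (h : ∑' n, z.1 n ^ 2 ≤ r ^ 2) : ‖z‖ ≤ r := by
  refine norm_le_of_modular_div_le_one hr ?_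
  rwa [modular_square (summable_sq z), ENNReal.ofReal_le_one, div_le_one (by positivity)]

/-- Hilbert space embeds into `h_N` as soon as `N` is doubling. -/
theorem exists_hasStrongControl_square (hN : N.IsDoubling) :
    ∃ f : square.hSpace → N.hSpace, HasStrongControl f := by
  obtain ⟨Y, hY, hYp, hYn⟩ := N.exists_mazur
  obtain ⟨T, hT1, hT0⟩ : ∃ T : ℝ, 1 < N T ∧ 0 < T :=
    ((N.tendsto_atTop.eventually_gt_atTop 1).and (eventually_gt_atTop 0)).exists
  have hYT : ∀ (x : square.hSpace) I, |Y (fockVector x.1 I)| ≤ T := fun x I => by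
    by_contra! hlt
    have h1 := N.strictMono hT0.le hlt
    rw [hY] at h1
    have h2 := le_hasSum (hasSum_fockVector_sq (summable_sq x)) I fun _ _ => sq_nonneg _
    linarith
  -- The factor `1 / 2` matches the halving in `mazur_upper`.
  let Φ : square.hSpace → (Σ k : ℕ, (Fin k → ℕ)) → ℝ := fun x I => Y (fockVector x.1 I) / 2
  have hΦ : ∀ x y I, |Φ x I - Φ y I| =
      |Y (fockVector x.1 I) - Y (fockVector y.1 I)| / 2 := fun x y I => by
    rw [← sub_div, abs_div, abs_of_pos (show (0 : ℝ) < 2 by norm_num)]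
  have hΦT : ∀ x y I, |Φ x I - Φ y I| ≤ T := fun x y I => by
    have := abs_sub (Y (fockVector x.1 I)) (Y (fockVector y.1 I))
    have := hYT x I
    have := hYT y I
    rw [hΦ]
    linarith
  let D : square.hSpace → square.hSpace → ℝ := fun x y => ∑' n, (x.1 n - y.1 n) ^ 2
  have hD : ∀ x y : square.hSpace, D x y = ∑' n, (x - y).1 n ^ 2 := fun x y => rfl
  have hD0 : ∀ x y, 0 ≤ D x y := fun x y => tsum_nonneg fun n => sq_nonneg _
  have hup : ∀ (x y) (η : ℝ), 0 < η → N.modular (Φ x - Φ y) ≤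
      ENNReal.ofReal ((2 - 2 * Real.exp (-D x y)) / (2 * η) + η * (1 + 1)) := fun x y η hη => by
    have hs := ((hasSum_fockVector_sub_sq (summable_sq x) (summable_sq y)).div_const (2 * η)).add
      (((hasSum_fockVector_sq (summable_sq x)).add
        (hasSum_fockVector_sq (summable_sq y))).mul_left η)
    rw [← hs.tsum_eq, ENNReal.ofReal_tsum_of_nonneg (fun I => by positivity) hs.summable]
    refine ENNReal.tsum_le_tsum fun I => ENNReal.ofReal_le_ofReal ?_
    rw [Pi.sub_apply, hΦ]
    exact mazur_upper hY hYp hYn hη _ _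
  obtain ⟨K, hK1, hK⟩ := hN 2 T one_le_two
  have hlow : ∀ δ : ℝ, 0 < δ → δ ≤ 1 / 2 → ∃ K' : ℝ, 0 < K' ∧ ∀ (x y) (η : ℝ), 0 ≤ η →
      N.modular (Φ x - Φ y) ≤ ENNReal.ofReal η →
      1 - Real.exp (-D x y) ≤ δ * K * 2 + 2 * δ * K' * η := by
    intro δ hδ hδ1
    obtain ⟨K', hK'1, hK'⟩ := hN (2 / δ) T (by rw [le_div_iff₀ hδ]; linarith)
    refine ⟨K', by linarith, fun x y η hη0 hη => ?_⟩
    have hs := (hasSum_fockVector_sub_sq (summable_sq x) (summable_sq y)).div_const 2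
    have hm := summable_of_modular_ne_top (ne_top_of_le_ne_top ENNReal.ofReal_ne_top hη)
    have hmη : ∑' I, N |(Φ x - Φ y) I| ≤ η := by
      rw [modular, ← ENNReal.ofReal_tsum_of_nonneg (fun I => N.nonneg (abs_nonneg _)) hm] at hη
      exact (ENNReal.ofReal_le_ofReal_iff hη0).1 hη
    have hs' := (((hasSum_fockVector_sq (summable_sq x)).add
        (hasSum_fockVector_sq (summable_sq y))).mul_left (δ * K)).add
        (hm.hasSum.mul_left (2 * δ * K'))
    have h1 := hasSum_le (fun I => ?_) hs hs'
    · have : 2 * δ * K' * ∑' I, N |(Φ x - Φ y) I| ≤ 2 * δ * K' * η := by gcongr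
      simp only [D]
      linarith
    · refine (mazur_lower hY hYp hYn (by linarith) hK hδ hδ1 (hYT x I) (hYT y I)).trans ?_
      rw [mul_assoc (2 * δ)]
      gcongr
      have h2 := hK' _ (abs_nonneg _) (hΦT x y I)
      rw [hΦ] at h2
      rw [Pi.sub_apply, hΦ]
      rwa [div_mul_div_comm, mul_comm δ, mul_div_mul_left _ _ two_ne_zero] at h2
  -- The sphere is bounded, so one constant serves all distances: `η = 1` in the upper estimate
  -- gives at most `1 + 2`.
  refine exists_hasStrongControl_of_bounded_scale hN Φ T hΦT (fun S => ⟨3, by norm_num,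
    fun x y _ => ?_⟩) (fun ε hε => ?_) (fun ε hε => ?_)
  · refine (hup x y 1 one_pos).trans (ENNReal.ofReal_le_ofReal ?_)
    have := Real.exp_pos (-D x y)
    linarith
  · refine ⟨ε / 4, by positivity, fun x y hxy => ?_⟩
    refine (hup x y (ε / 4) (by positivity)).trans (ENNReal.ofReal_le_ofReal ?_)
    have h1 := tsum_sq_le_of_norm_lt hxy
    rw [← hD] at h1
    have h2 := Real.add_one_le_exp (-D x y)
    have h3 : (2 - 2 * Real.exp (-D x y)) / (2 * (ε / 4)) ≤ ε / 2 := by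
      rw [div_le_iff₀ (by positivity)]
      nlinarith
    linarith
  · set κ := 1 - Real.exp (-(ε / 2) ^ 2) with hκ
    have hκ0 : 0 < κ := by
      rw [hκ, sub_pos, Real.exp_lt_one_iff]
      have : 0 < (ε / 2) ^ 2 := by positivity
      linarith
    have hK0 : 0 < K := by linarith
    -- The order of choices matters: `δ` first makes the constant term at most `κ / 2`, then the
    -- modular bound is chosen in terms of the resulting `K'` to make the other term `κ / 2`.
    obtain ⟨K', hK', hle⟩ := hlow (min (1 / 2) (κ / (4 * K))) (by positivity) (min_le_left _ _)
    set δ := min (1 / 2) (κ / (4 * K)) with hδ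
    have hδ0 : 0 < δ := by positivity
    refine ⟨κ / (4 * δ * K'), by positivity, fun x y hxy => ?_⟩
    have h1 := hle x y _ (by positivity) hxy
    have h2 : δ * K * 2 ≤ κ / 2 := by
      calc δ * K * 2 ≤ κ / (4 * K) * K * 2 := by gcongr; exact min_le_right _ _
        _ = κ / 2 := by field_simp; norm_num
    have h3 : 2 * δ * K' * (κ / (4 * δ * K')) = κ / 2 := by field_simp; norm_num
    have h4 : D x y ≤ (ε / 2) ^ 2 := by
      have h5 : Real.exp (-(ε / 2) ^ 2) ≤ Real.exp (-D x y) := by linarith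
      linarith [Real.exp_le_exp.1 h5]
    have h5 := norm_le_of_tsum_sq_le (z := x - y) (half_pos hε) h4
    linarith

end OrliczFunction

/-! ### An Aharoni type embedding into `c₀` -/

section Aharoni

variable {X : Type*} [PseudoMetricSpace X]

/-- The cells of the disjoint cover by balls of radius `r` around the points `u k`. -/
def ballCell (u : ℕ → X) (r : ℝ) (k : ℕ) : Set X :=
  Metric.ball (u k) r \ ⋃ i < k, Metric.ball (u i) r

/-- A bounded Lipschitz function that is large on the `k`-th cell and vanishes away from it. -/
noncomputable def cellBump (u : ℕ → X) (r : ℝ) (k : ℕ) (x : X) : ℝ :=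
  open Classical in
  if (ballCell u r k).Nonempty then max 0 (r / 2 - Metric.infDist x (ballCell u r k)) else 0

variable {u : ℕ → X} {r : ℝ}

theorem cellBump_nonneg (k : ℕ) (x : X) : 0 ≤ cellBump u r k x := by
  rw [cellBump]
  split_ifs
  · exact le_max_left _ _
  · exact le_rfl

theorem cellBump_le (hr : 0 ≤ r) (k : ℕ) (x : X) : cellBump u r k x ≤ r / 2 := by
  rw [cellBump]
  split_ifs
  · exact max_le (by positivity) (by linarith [Metric.infDist_nonneg (x := x) (s := ballCell u r k)])
  · positivity

theorem abs_cellBump_sub_le (k : ℕ) (x y : X) :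
    |cellBump u r k x - cellBump u r k y| ≤ dist x y := by
  rw [cellBump, cellBump]
  split_ifs
  · have h1 := abs_max_sub_max_le_abs (r / 2 - Metric.infDist x (ballCell u r k))
      (r / 2 - Metric.infDist y (ballCell u r k)) 0
    rw [max_comm 0, max_comm 0]
    refine h1.trans ?_
    rw [sub_sub_sub_cancel_left, abs_sub_comm]
    exact (Metric.lipschitz_infDist_pt (ballCell u r k)).dist_le_mul x y |>.trans_eq (by simp)
  · simp

theorem exists_mem_ballCell (hu : DenseRange u) (hr : 0 < r) (x : X) : ∃ k, x ∈ ballCell u r k := by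
  classical
  have h : ∃ k, x ∈ Metric.ball (u k) r := by
    obtain ⟨k, hk⟩ := hu.exists_dist_lt x hr
    exact ⟨k, hk⟩
  refine ⟨Nat.find h, Nat.find_spec h, ?_⟩
  simp only [mem_iUnion, not_exists]
  exact fun i hi => Nat.find_min h hi

/-- A cell has points less than `2 * r` apart and its bump reaches only `r / 2` beyond it. -/
theorem cellBump_eq_zero_of_dist {k : ℕ} {x y : X} (hx : x ∈ ballCell u r k)
    (h : 5 / 2 * r ≤ dist x y) : cellBump u r k y = 0 := by
  rw [cellBump, if_pos ⟨x, hx⟩]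
  refine max_eq_left (sub_nonpos.2 ((Metric.le_infDist ⟨x, hx⟩).2 fun z hz => ?_))
  have h1 : dist x (u k) < r := hx.1
  have h2 : dist z (u k) < r := hz.1
  have h3 := dist_triangle4 x (u k) z y
  rw [dist_comm (u k) z, dist_comm z y] at h3
  linarith

theorem cellBump_of_mem (hr : 0 ≤ r) {k : ℕ} {x : X} (hx : x ∈ ballCell u r k) :
    cellBump u r k x = r / 2 := by
  rw [cellBump, if_pos ⟨x, hx⟩, Metric.infDist_zero_of_mem hx, sub_zero]
  exact max_eq_right (by positivity)

/-- Some `u m` lies within `r / 2` of `x`. All later cells avoid the ball of radius `r` around `u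
m`, so they stay at distance at least `r / 2` from `x`. -/
theorem finite_cellBump_ne_zero (hu : DenseRange u) (hr : 0 < r) (x : X) :
    {k | cellBump u r k x ≠ 0}.Finite := by
  obtain ⟨m, hm⟩ := hu.exists_dist_lt x (half_pos hr)
  refine (finite_Iic m).subset fun k hk => ?_
  by_contra hlt
  rw [mem_Iic, not_le] at hlt
  refine hk ?_
  rw [cellBump]
  split_ifs with hne
  · refine max_eq_left (sub_nonpos.2 ((Metric.le_infDist hne).2 fun z hz => ?_))
    have h1 : r ≤ dist z (u m) := by
      by_contra! hcon
      exact hz.2 (mem_iUnion₂.2 ⟨m, hlt, hcon⟩)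
    have h2 := dist_triangle z x (u m)
    rw [dist_comm z x] at h2
    linarith
  · rfl

/-- A separable metric space with the square root of its metric embeds into `c₀`, up to
constants. -/
theorem exists_sqrt_embedding_c0 (X : Type*) [PseudoMetricSpace X]
    [TopologicalSpace.SeparableSpace X] [Nonempty X] :
    ∃ f : X → ℤ × ℕ → ℝ, (∀ x y a, |f x a - f y a| ≤ √(dist x y)) ∧
      (∀ x y, 0 < dist x y → ∃ a, √(dist x y) / 10 ≤ |f x a - f y a|) ∧
      ∀ x y (ε : ℝ), 0 < ε → {a | ε ≤ |f x a - f y a|}.Finite := by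
  obtain ⟨u, hu⟩ := TopologicalSpace.exists_dense_seq X
  have hr : ∀ j : ℤ, (0 : ℝ) < 4 ^ j := fun j => by positivity
  have h42 : ∀ j : ℤ, (4 : ℝ) ^ j = 2 ^ j * 2 ^ j := fun j => by
    rw [← mul_zpow]
    norm_num
  -- With radius `4 ^ j` and factor `2 ^ (-j)`, differences are at most both `2 ^ (-j) * d` and `2 ^
  -- j`. Their geometric mean is `√d`, and for fixed points one of them tends to zero at either end
  -- of the scales.
  let f : X → ℤ × ℕ → ℝ := fun x a => (2 ^ a.1)⁻¹ * cellBump u (4 ^ a.1) a.2 x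
  have hf : ∀ x y a, |f x a - f y a| =
      (2 ^ a.1)⁻¹ * |cellBump u (4 ^ a.1) a.2 x - cellBump u (4 ^ a.1) a.2 y| := fun x y a => by
    rw [← mul_sub, abs_mul, abs_of_pos (by positivity)]
  have hf1 : ∀ x y a, |f x a - f y a| ≤ (2 ^ a.1)⁻¹ * dist x y := fun x y a => by
    rw [hf]
    gcongr
    exact abs_cellBump_sub_le _ _ _
  have hf2 : ∀ x y a, |f x a - f y a| ≤ 2 ^ a.1 := fun x y a => by
    have h1 : |cellBump u (4 ^ a.1) a.2 x - cellBump u (4 ^ a.1) a.2 y| ≤ 4 ^ a.1 := by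
      have := cellBump_nonneg (u := u) (r := 4 ^ a.1) a.2 x
      have := cellBump_nonneg (u := u) (r := 4 ^ a.1) a.2 y
      have := cellBump_le (u := u) (hr a.1).le a.2 x
      have := cellBump_le (u := u) (hr a.1).le a.2 y
      have := hr a.1
      exact abs_le.2 ⟨by linarith, by linarith⟩
    rw [hf, inv_mul_le_iff₀ (by positivity), ← h42]
    exact h1
  refine ⟨f, fun x y a => ?_, fun x y hxy => ?_, fun x y ε hε => ?_⟩
  · refine Real.le_sqrt_of_sq_le ?_
    rw [sq]
    calc |f x a - f y a| * |f x a - f y a| ≤ (2 ^ a.1)⁻¹ * dist x y * 2 ^ a.1 := by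
          gcongr
          · exact hf1 x y a
          · exact hf2 x y a
      _ = dist x y := by field_simp
  · obtain ⟨j, hj1, hj2⟩ := exists_mem_Ioc_zpow (show 0 < dist x y / (5 / 2) by positivity)
      (show (1 : ℝ) < 4 by norm_num)
    obtain ⟨k, hk⟩ := exists_mem_ballCell hu (hr j) x
    refine ⟨(j, k), ?_⟩
    rw [lt_div_iff₀ (by norm_num)] at hj1
    rw [div_le_iff₀ (by norm_num), zpow_add_one₀ (by norm_num)] at hj2
    rw [hf, cellBump_of_mem (hr j).le hk, cellBump_eq_zero_of_dist hk (by linarith), sub_zero,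
      abs_of_pos (by positivity)]
    have h1 : √(dist x y) ≤ 5 * 2 ^ j := by
      refine Real.sqrt_le_iff.2 ⟨by positivity, ?_⟩
      have := h42 j
      have := hr j
      nlinarith
    have h2 : (2 ^ j : ℝ)⁻¹ * (4 ^ j / 2) = 2 ^ j / 2 := by
      rw [h42]
      field_simp
    dsimp only
    rw [h2]
    linarith
  · obtain ⟨A, hA⟩ := exists_nat_gt ε⁻¹
    obtain ⟨B, hB⟩ := exists_nat_gt (dist x y / ε)
    have h2 : ∀ n : ℕ, (n : ℝ) ≤ 2 ^ n := fun n => by exact_mod_cast Nat.lt_two_pow_self.le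
    have hsub : {a : ℤ × ℕ | ε ≤ |f x a - f y a|} ⊆ ⋃ j ∈ Icc (-(A : ℤ)) B,
        (fun k => (j, k)) '' ({k | cellBump u (4 ^ j) k x ≠ 0} ∪
          {k | cellBump u (4 ^ j) k y ≠ 0}) := by
      rintro ⟨j, k⟩ hjk
      rw [mem_ofPred_eq] at hjk
      refine mem_iUnion₂.2 ⟨j, ⟨?_, ?_⟩, k, ?_, rfl⟩
      · by_contra! hlt
        have h3 := hjk.trans (hf2 x y (j, k))
        have h4 : (2 : ℝ) ^ j ≤ 2 ^ (-(A : ℤ)) := zpow_le_zpow_right₀ one_le_two hlt.le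
        rw [zpow_neg, zpow_natCast] at h4
        have h5 := h3.trans h4
        rw [le_inv_comm₀ hε (by positivity)] at h5
        linarith [h2 A]
      · by_contra! hlt
        have h3 := hjk.trans (hf1 x y (j, k))
        have h4 : (2 : ℝ) ^ (B : ℤ) ≤ 2 ^ j := zpow_le_zpow_right₀ one_le_two hlt.le
        rw [zpow_natCast] at h4
        rw [le_inv_mul_iff₀ (by positivity)] at h3
        rw [div_lt_iff₀ hε] at hB
        have h5 := (h2 B).trans h4
        have h6 : (B : ℝ) * ε ≤ 2 ^ j * ε := by gcongr
        linarith
      · by_contra hcon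
        simp only [mem_union, mem_ofPred_eq, not_or, not_not] at hcon
        rw [hf] at hjk
        simp only [hcon.1, hcon.2, sub_zero, abs_zero, mul_zero] at hjk
        linarith
    refine Finite.subset ((finite_Icc _ _).biUnion fun j _ => Finite.image _ ?_) hsub
    exact (finite_cellBump_ne_zero hu (hr j) x).union (finite_cellBump_ne_zero hu (hr j) y)

end Aharoni

/-! ### A copy of `c₀` for infinite upper index -/

namespace OrliczFunction

variable {M N : OrliczFunction}

/-- A huge exponent makes the block nearly a step: a full coordinate costs at least `1`, half a
coordinate almost nothing. -/
theorem exists_c0_block (h : N.upperIndex = ⊤) {ε : ℝ} (hε : 0 < ε) :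
    ∃ (l : ℝ) (k : ℕ), 0 < l ∧ 1 ≤ k * N l ∧ k * N (l * (1 / 2)) ≤ ε := by
  obtain ⟨n, hn⟩ := exists_pow_lt_of_lt_one (show 0 < ε / 4 by positivity)
    (show (1 / 2 : ℝ) < 1 by norm_num)
  obtain ⟨l, k, hl, -, h1, h2⟩ := exists_block (N := N) one_pos (p := max 1 (n : ℝ)) (ε := ε / 2)
    (le_max_left _ _) (by rw [h]; exact EReal.coe_lt_top _) (by positivity)
  refine ⟨l, k, hl, h1, (h2 (1 / 2) (by norm_num) (by norm_num)).trans ?_⟩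
  have h3 : (1 / 2 : ℝ) ^ max 1 (n : ℝ) ≤ (1 / 2) ^ n := by
    rw [← Real.rpow_natCast]
    exact Real.rpow_le_rpow_of_exponent_ge (by norm_num) (by norm_num) (le_max_right _ _)
  linarith

/-- If the upper index of `N` is infinite then `h_N` contains `c₀`. -/
theorem exists_c0_map (h : N.upperIndex = ⊤) (ι : Type) [Countable ι] :
    ∃ (κ : Type) (_ : Countable κ) (S : (ι → ℝ) → κ → ℝ),
      (∀ v w, S v - S w = S (v - w)) ∧ (∀ v (r : ℝ), (fun a => S v a / r) = S fun i => v i / r) ∧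
      (∀ v, (∀ i, |v i| ≤ 1 / 2) → N.modular (S v) ≤ 1) ∧
      (∀ v, N.modular (S v) ≤ 1 → ∀ i, |v i| ≤ 1) ∧
      ∀ v, {i | 1 / 2 ≤ |v i|}.Finite → N.modular (S v) ≠ ⊤ := by
  obtain ⟨ε, hε, hεs⟩ := ENNReal.exists_pos_sum_of_countable one_ne_zero ι
  choose l k hl hk1 hk2 using fun i => exists_c0_block h (NNReal.coe_pos.2 (hε i))
  have hsmall : ∀ v : ι → ℝ, ∀ i, |v i| ≤ 1 / 2 →
      ENNReal.ofReal (k i * N (l i * |v i|)) ≤ ε i := fun v i hi => by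
    rw [← ENNReal.ofReal_coe_nnreal (p := ε i)]
    refine ENNReal.ofReal_le_ofReal (le_trans ?_ (hk2 i))
    gcongr
    have := hl i
    exact N.mono (by positivity) (by gcongr)
  refine ⟨Σ i, Fin (k i), inferInstance, fun v a => l a.1 * v a.1, fun v w => ?_, fun v r => ?_,
    fun v hv => ?_, fun v hv i => ?_, fun v hv => ?_⟩
  · funext a
    simp only [Pi.sub_apply]
    ring
  · funext a
    ring
  · rw [modular_sigma_fin l v hl]
    exact (ENNReal.tsum_le_tsum fun i => hsmall v i (hv i)).trans hεs.le
  · rw [modular_sigma_fin l v hl] at hv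
    by_contra! hlt
    have h1 := ENNReal.ofReal_le_one.1 ((ENNReal.le_tsum i).trans hv)
    have h2 := N.le_map_mul (hl i).le hlt.le
    have h3 : (k i : ℝ) * (|v i| * N (l i)) ≤ 1 := le_trans (by gcongr) h1
    nlinarith [hk1 i]
  · classical
    rw [modular_sigma_fin l v hl]
    have hle : ∀ i, ENNReal.ofReal (k i * N (l i * |v i|)) ≤
        (if i ∈ hv.toFinset then ENNReal.ofReal (k i * N (l i * |v i|)) else 0) + ε i := fun i => by
      split_ifs with hi
      · exact le_self_add
      · rw [zero_add]
        refine hsmall v i (le_of_lt ?_)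
        simpa using hi
    refine ne_top_of_le_ne_top ?_ (ENNReal.tsum_le_tsum hle)
    rw [ENNReal.tsum_add]
    refine ENNReal.add_ne_top.2 ⟨?_, ne_top_of_lt hεs⟩
    rw [tsum_eq_sum (s := hv.toFinset) fun i hi => if_neg hi]
    refine ENNReal.sum_ne_top.2 fun i hi => ?_
    rw [if_pos hi]
    exact ENNReal.ofReal_ne_top

/-- The block map distorts the supremum norm by at most a factor `2`, so all four controls follow
from comparability of the image distance with `√(dist x y)`. -/
theorem exists_hasStrongControl_of_upperIndex_eq_top (h : N.upperIndex = ⊤) (X : Type*)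
    [MetricSpace X] [TopologicalSpace.SeparableSpace X] [Nonempty X] :
    ∃ f : X → N.hSpace, HasStrongControl f := by
  obtain ⟨g, hg1, hg2, hg3⟩ := exists_sqrt_embedding_c0 X
  obtain ⟨κ, _, S, hS1, hS2, hS3, hS4, hS5⟩ := exists_c0_map h (ℤ × ℕ)
  obtain ⟨e, he⟩ := exists_injective_nat κ
  obtain ⟨x₀⟩ := ‹Nonempty X›
  let z : (ℤ × ℕ → ℝ) → ℕ → ℝ := fun v => Function.extend e (S v) 0
  have hdiv : ∀ v (r : ℝ), (fun n => z v n / r) = z fun i => v i / r := fun v r => by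
    funext n
    by_cases hn : ∃ a, e a = n
    · obtain ⟨a, rfl⟩ := hn
      simp only [z, he.extend_apply]
      exact congrFun (hS2 v r) a
    · simp [z, Function.extend_apply' _ _ _ hn]
  have hsub : ∀ v w, z v - z w = z (v - w) := fun v w => by
    funext n
    by_cases hn : ∃ a, e a = n
    · obtain ⟨a, rfl⟩ := hn
      simp only [z, he.extend_apply, Pi.sub_apply, ← hS1 v w]
    · simp [z, Function.extend_apply' _ _ _ hn]
  have hmod : ∀ v, N.modular (z v) = N.modular (S v) := fun v => modular_extend he _
  have hfin : ∀ x (r : ℝ), 0 < r → N.modular (fun n => z (g x - g x₀) n / r) ≠ ⊤ := by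
    intro x r hr
    rw [hdiv, hmod]
    refine hS5 _ ((hg3 x x₀ (r / 2) (half_pos hr)).subset fun i hi => ?_)
    rw [mem_ofPred_eq, Pi.sub_apply, abs_div, abs_of_pos hr, le_div_iff₀ hr] at hi
    rw [mem_ofPred_eq]
    linarith
  let f : X → N.hSpace := fun x => mkH (z (g x - g x₀)) (hfin x)
  have hf : ∀ x y, (f x - f y).1.1 = z (g x - g y) := fun x y => by
    change z (g x - g x₀) - z (g y - g x₀) = _
    rw [hsub, sub_sub_sub_cancel_right]
  have hup : ∀ x y (r : ℝ), 0 < r → dist x y ≤ r → dist (f x) (f y) ≤ 2 * √r := by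
    intro x y r hr hxy
    have hr' := Real.sqrt_pos.2 hr
    rw [dist_eq_norm]
    refine norm_le_of_modular_div_le_one (by positivity) ?_
    rw [hf, hdiv, hmod]
    refine hS3 _ fun i => ?_
    rw [abs_div, abs_of_pos (show 0 < 2 * √r by positivity), div_le_iff₀ (by positivity)]
    have := (hg1 x y i).trans (Real.sqrt_le_sqrt hxy)
    rw [Pi.sub_apply]
    linarith
  have hlow : ∀ x y (r : ℝ), dist (f x) (f y) < r → dist x y ≤ (10 * r) ^ 2 := by
    intro x y r hxy
    have hr : 0 < r := dist_nonneg.trans_lt hxy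
    rw [dist_eq_norm] at hxy
    have h1 := modular_div_le_one_of_norm_lt hxy
    rw [hf, hdiv, hmod] at h1
    rcases (dist_nonneg (x := x) (y := y)).eq_or_lt with h0 | h0
    · rw [← h0]
      positivity
    obtain ⟨i, hi⟩ := hg2 x y h0
    have h2 := hS4 _ h1 i
    rw [abs_div, abs_of_pos hr, div_le_one hr, Pi.sub_apply] at h2
    exact (Real.sqrt_le_left (by positivity)).1 (by linarith)
  refine ⟨f, ⟨fun R => ⟨2 * √(max R 1), fun x y hxy => ?_⟩, fun R => ⟨(10 * (max R 0 + 1)) ^ 2,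
    fun x y hxy => hlow x y _ ?_⟩, fun ε hε => ⟨(ε / 4) ^ 2, by positivity, fun x y hxy => ?_⟩,
    fun ε hε => ⟨√(ε / 2) / 10, by positivity, fun x y hxy => ?_⟩⟩⟩
  · exact hup x y _ (by positivity) (hxy.trans (le_max_left _ _))
  · have := le_max_left R 0
    linarith
  · have h1 := hup x y _ (by positivity) hxy.le
    rw [Real.sqrt_sq (by positivity)] at h1
    linarith
  · have h1 := hlow x y _ hxy
    rw [mul_div_cancel₀ _ (by norm_num), Real.sq_sqrt (by positivity)] at h1
    linarith

/-! ### Separability of `h_M` -/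

/-- The unit vectors of `h_M`. -/
def unitVector (M : OrliczFunction) (n : ℕ) : M.hSpace :=
  mkH (Pi.single n 1) fun r _ => by
    rw [modular, tsum_eq_single n fun m hm => by simp [Pi.single_eq_of_ne hm, M.map_zero]]
    exact ENNReal.ofReal_ne_top

/-- Membership in `h_M` makes the modular of `x / r` summable for this very `r`, so a tail of it is
at most `1`. -/
theorem norm_sub_sum_unitVector_le (x : M.hSpace) {r : ℝ} (hr : 0 < r) :
    ∃ k : ℕ, ‖x - ∑ n ∈ Finset.range k, x.1 n • M.unitVector n‖ ≤ r := by
  have hs := (x.2 r hr)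
  obtain ⟨k, hk⟩ := ((tendsto_sum_nat_add fun n => M (|x.1 n| / r)).eventually
    (ge_mem_nhds one_pos)).exists
  refine ⟨k, norm_le_of_modular_div_le_one hr ?_⟩
  have hcoord : ∀ m, (x - ∑ n ∈ Finset.range k, x.1 n • M.unitVector n).1 m =
      if m < k then 0 else x.1 m := fun m => by
    have e1 : ∀ s : Finset ℕ, (∑ n ∈ s, x.1 n • M.unitVector n).1 m = if m ∈ s then x.1 m else 0 := by
      intro s
      induction s using Finset.induction_on with
      | empty => rfl
      | insert a s ha ih =>
        rw [Finset.sum_insert ha]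
        change x.1 a * (Pi.single a 1 : ℕ → ℝ) m + (∑ n ∈ s, x.1 n • M.unitVector n).1 m = _
        rw [ih]
        rcases eq_or_ne m a with rfl | hma
        · simp [ha]
        · simp [hma]
    change x.1 m - (∑ n ∈ Finset.range k, x.1 n • M.unitVector n).1 m = _
    rw [e1]
    by_cases hm : m < k <;> simp [hm]
  rw [modular, ← ENNReal.summable.sum_add_tsum_nat_add' (k := k), Finset.sum_eq_zero, zero_add]
  · have hs' := (summable_nat_add_iff k).2 hs
    have e2 : ∀ m, M |(x - ∑ n ∈ Finset.range k, x.1 n • M.unitVector n).1 (m + k) / r| =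
        M (|x.1 (m + k)| / r) := fun m => by
      rw [hcoord, if_neg (by omega), abs_div, abs_of_pos hr]
    simp only [e2]
    rw [← ENNReal.ofReal_tsum_of_nonneg (fun m => M.nonneg_abs_div _ hr) hs']
    exact ENNReal.ofReal_le_one.2 hk
  · intro m hm
    rw [hcoord, if_pos (Finset.mem_range.1 hm)]
    simp [M.map_zero]

instance separableSpace_hSpace (M : OrliczFunction) : TopologicalSpace.SeparableSpace M.hSpace := by
  have h1 : TopologicalSpace.IsSeparable
      (Submodule.span ℝ (range M.unitVector) : Set M.hSpace) :=
    (countable_range _).isSeparable.span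
  refine TopologicalSpace.isSeparable_univ_iff.1 (h1.closure.mono fun x _ => ?_)
  refine Metric.mem_closure_iff.2 fun ε hε => ?_
  obtain ⟨k, hk⟩ := norm_sub_sum_unitVector_le x (half_pos hε)
  refine ⟨∑ n ∈ Finset.range k, x.1 n • M.unitVector n, Submodule.sum_mem _ fun n _ =>
    Submodule.smul_mem _ _ (Submodule.subset_span (mem_range_self n)), ?_⟩
  rw [dist_eq_norm]
  exact hk.trans_lt (half_lt_self hε)

end OrliczFunction

/-! ### Assembling the cases -/

open OrliczFunction in
theorem theorem4p2 (M N : OrliczFunction)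
    (h : M.upperIndex < N.upperIndex ∨
      (N.upperIndex ≤ M.upperIndex ∧ M.upperIndex < 2) ∨
      (M.upperIndex = ⊤ ∧ N.upperIndex = ⊤)) :
    StronglyUniformlyEmbeds M.hSpace N.hSpace := by
  suffices hf : ∃ f : M.hSpace → N.hSpace, HasStrongControl f by
    obtain ⟨f, hf⟩ := hf
    exact hf.stronglyUniformlyEmbeds
  -- An infinite target index is settled first, by `c₀`; afterwards `N` is doubling, as the other
  -- two constructions require.
  by_cases hN : N.upperIndex = ⊤
  · exact exists_hasStrongControl_of_upperIndex_eq_top hN _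
  have hN' : N.upperIndex < ⊤ := lt_top_iff_ne_top.2 hN
  rcases h with h | ⟨-, h⟩ | ⟨-, h⟩
  · exact exists_hasStrongControl_of_upperIndex_lt h hN'
  · obtain ⟨f, hf⟩ := exists_hasStrongControl_of_upperIndex_lt (M := M) (N := square)
      (by rwa [upperIndex_square]) (by rw [upperIndex_square]; exact EReal.coe_lt_top 2)
    obtain ⟨g, hg⟩ := exists_hasStrongControl_square (isDoubling_of_upperIndex_lt_top hN')
    exact ⟨g ∘ f, hg.comp hf⟩
  · exact absurd h hN
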